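/- Let $g\ge 2$ be an integer and let $V=\mathbb{Q}[x_1,x_2,\ldots]$, graded by $\deg x_i=i$; write $\partial_i=\partial/\partial x_i$ and $x_1^{[a]}=x_1^a/a!$ for $a\ge 0$, $x_1^{[a]}=0$ for $a<0$. Put $$D=-g\partial_1+\frac12\sum_{m,n\ge 1}\binom{m+n}{m}x_{m+n-1}\partial_m\partial_n,\qquad D_k=\frac1{k!}\sum_{n_1,\ldots,n_k\ge 1}\frac{(n_1+\ldots+n_k)!}{n_1!\cdots n_k!}\,x_{n_1+\ldots+n_k-1}\,\partial_{n_1}\cdots\partial_{n_k}\quad(k\ge 2).$$ Let $I_g\subset V$ be the linear span of all homogeneous polynomials of degree $>g$ and of all polynomials $D^d(x_1^{m_1}\cdots x_k^{m_k})$ with $d\ge 0$, $m_1+2m_2+\ldots+km_k=g$, $m_1<g$. Let $S:V\to V$ be the linear operator such that, for all $n\ge 0$, $k\ge 0$ and $n_1,\ldots,n_k>1$, $$(-1)^nS(x_1^{[n]}x_{n_1}\cdots x_{n_k})=\sum_{\{1,\ldots,k\}=I_1\sqcup\ldots\sqcup I_m}b(I_1)\cdots b(I_m)\,x_1^{[g-n-m-\sum_i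 n_i]}\,x_{d(I_1)}\cdots x_{d(I_m)},$$ where the sum is over the unordered partitions of $\{1,\ldots,k\}$ into nonempty subsets (for $k=0$ the only one is the empty partition, $m=0$), $b(I)=(\sum_{i\in I}n_i)!/\prod_{i\in I}n_i!$ and $d(I)=\sum_{i\in I}n_i-|I|+1$. Then: (a) $D=D_2-g\partial_1$, and $[D_k,D]=0$ on $V$ for every $k\ge 3$. (b) $I_g$ is an ideal of $V$, so that $R_g^{\mathrm{Jac}}=V/I_g$ is a commutative ring; $S$ descends to an invertible linear operator (again denoted $S$) on $R_g^{\mathrm{Jac}}$, and $D_k$ descends to a linear operator on $R_g^{\mathrm{Jac}}$ for every $k\ge 3$. (c) Let $p_k$ be the class of $x_k$ in $R_g^{\mathrm{Jac}}$. For every $k\ge 2$ and every $F\in R_g^{\mathrm{Jac}}$ one has $$S(p_k\cdot S^{-1}F)=D_{k+1}(F).$$ -/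

import Mathlib

open scoped Nat

namespace JacTaut

noncomputable section

/-- The polynomial ring `ℚ[x₁, x₂, …]`. -/
abbrev V : Type := MvPolynomial ℕ+ ℚ

/-- The variable `x_n`, for a natural number `n ≥ 1` (the value at `n = 0` is never used). -/
def x (n : ℕ) : V := MvPolynomial.X n.toPNat'

/-- The iterated partial derivative `∂_{n₁} … ∂_{n_k}`, for a list `[n₁, …, n_k]`. -/
def partials (l : List ℕ+) : Module.End ℚ V :=
  (l.map fun n => (MvPolynomial.pderiv n : Derivation ℚ V V).toLinearMap).prod

theorem exists_of_coeff_partials_ne_zero (F : V) (l : List ℕ+) :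
    ∀ m : ℕ+ →₀ ℕ, (partials l F).coeff m ≠ 0 →
      ∃ m' : ℕ+ →₀ ℕ, F.coeff m' ≠ 0 ∧ m ≤ m' ∧ ∀ i ∈ l, 0 < m' i := by
  induction l with
  | nil => intro m hm; exact ⟨m, by simpa [partials] using hm, le_rfl, by simp⟩
  | cons a l ih =>
    intro m hm
    have h1 : partials (a :: l) F = MvPolynomial.pderiv a (partials l F) := by
      simp [partials]
    rw [h1, MvPolynomial.coeff_pderiv] at hm
    obtain ⟨m', h, hle, hpos⟩ := ih _ (left_ne_zero_of_mul hm)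
    refine ⟨m', h, le_trans (by simp) hle, ?_⟩
    intro i hi
    rcases List.mem_cons.mp hi with rfl | hi
    · have := hle i
      simp at this
      omega
    · exact hpos i hi

theorem mem_vars_of_partials_ne_zero {F : V} {l : List ℕ+} (h : partials l F ≠ 0) :
    ∀ i ∈ l, i ∈ F.vars := by
  obtain ⟨m, hm⟩ := MvPolynomial.ne_zero_iff.mp h
  obtain ⟨m', h1, -, h2⟩ := exists_of_coeff_partials_ne_zero F l m hm
  intro i hi
  exact (MvPolynomial.mem_vars_iff_mem_support i).mpr
    ⟨m', MvPolynomial.mem_support_iff.mpr h1, Finsupp.mem_support_iff.mpr (h2 i hi).ne'⟩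

/-- Only finitely many of the derivatives `∂_{n₁} … ∂_{n_k} F` are nonzero. -/
theorem finite_support_diffOp {k : ℕ} (c : (Fin k → ℕ+) → V) (F : V) :
    (Function.support fun n : Fin k → ℕ+ => c n * partials (List.ofFn n) F).Finite := by
  refine (Fintype.piFinset fun _ : Fin k => F.vars).finite_toSet.subset ?_
  intro n hn
  have h : partials (List.ofFn n) F ≠ 0 := right_ne_zero_of_mul hn
  simp only [Finset.mem_coe, Fintype.mem_piFinset]
  exact fun i => mem_vars_of_partials_ne_zero h _ (by simp [List.mem_ofFn])

/-- The differential operator `∑_{n₁, …, n_k ≥ 1} c(n₁, …, n_k) ∂_{n₁} … ∂_{n_k}` with polynomial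
coefficients; applied to a given polynomial, the sum has only finitely many nonzero terms. -/
def diffOp {k : ℕ} (c : (Fin k → ℕ+) → V) : Module.End ℚ V where
  toFun F := ∑ᶠ n : Fin k → ℕ+, c n * partials (List.ofFn n) F
  map_add' F G := by
    rw [← finsum_add_distrib (finite_support_diffOp c F) (finite_support_diffOp c G)]
    simp only [map_add, mul_add]
  map_smul' a F := by
    rw [RingHom.id_apply, smul_finsum' a (finite_support_diffOp c F)]
    simp only [map_smul, mul_smul_comm]

/-- `D_k = (1/k!) ∑_{n₁, …, n_k ≥ 1} (n₁ + … + n_k)! / (n₁! … n_k!)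
  x_{n₁ + … + n_k - 1} ∂_{n₁} … ∂_{n_k}` (used for `k ≥ 2`). -/
def Dk (k : ℕ) : Module.End ℚ V :=
  (1 / (k ! : ℚ)) • diffOp fun n : Fin k → ℕ+ =>
    (((∑ i, (n i : ℕ)) ! : ℚ) / ∏ i, ((n i : ℕ) ! : ℚ)) • x ((∑ i, (n i : ℕ)) - 1)

/-- The partial derivative `∂₁`. -/
def partialOne : Module.End ℚ V := (MvPolynomial.pderiv 1 : Derivation ℚ V V).toLinearMap

/-- `D = -g ∂₁ + (1/2) ∑_{m, n ≥ 1} binom(m + n, m) x_{m + n - 1} ∂_m ∂_n`. -/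
def D (g : ℕ) : Module.End ℚ V :=
  -((g : ℚ) • partialOne) + (1 / 2 : ℚ) • diffOp fun n : Fin 2 → ℕ+ =>
    (((n 0 : ℕ) + (n 1 : ℕ)).choose (n 0 : ℕ) : ℚ) • x ((n 0 : ℕ) + (n 1 : ℕ) - 1)

/-- The grading `deg x_i = i`. -/
def deg : ℕ+ → ℕ := fun i => i

/-- The subspace `I_g`: the span of all polynomials that are homogeneous of degree `> g`
(for `deg x_i = i`), together with all `D^d (x₁^{m₁} … x_k^{m_k})` with `d ≥ 0`,
`m₁ + 2 m₂ + … + k m_k = g` and `m₁ < g`. -/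
def relations (g : ℕ) : Submodule ℚ V :=
  Submodule.span ℚ
    ({F : V | ∃ n : ℕ, g < n ∧ MvPolynomial.IsWeightedHomogeneous deg F n} ∪
     {F : V | ∃ (d : ℕ) (m : ℕ+ →₀ ℕ), Finsupp.weight deg m = g ∧ m 1 < g ∧
        F = (D g ^ d) (MvPolynomial.monomial m 1)})

/-- The right-hand side of the formula for the Fourier transform of
`x₁^[n] x_{n₁} … x_{n_k}`, up to the sign `(-1)^n`:
`∑ b(I₁) … b(I_m) x₁^[g - n - m - ∑ n_i] x_{d(I₁)} … x_{d(I_m)}`, over all partitions of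
`{1, …, k}` into nonempty subsets `I₁, …, I_m` with `m ≤ g - n - ∑ n_i`, where
`b(I) = (∑_{i ∈ I} n_i)! / ∏_{i ∈ I} n_i!`, `d(I) = ∑_{i ∈ I} n_i - |I| + 1` and
`x₁^[a] = x₁^a / a!`. -/
def fourierSum (g n : ℕ) {k : ℕ} (ν : Fin k → ℕ+) : V :=
  ∑ P : Finpartition (Finset.univ : Finset (Fin k)),
    if n + P.parts.card + ∑ i, (ν i : ℕ) ≤ g then
      ((1 / ((g - n - P.parts.card - ∑ i, (ν i : ℕ)) ! : ℚ)) •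
          x 1 ^ (g - n - P.parts.card - ∑ i, (ν i : ℕ))) *
        ∏ I ∈ P.parts,
          ((((∑ i ∈ I, (ν i : ℕ)) ! : ℚ) / ∏ i ∈ I, ((ν i : ℕ) ! : ℚ)) •
            x ((∑ i ∈ I, (ν i : ℕ)) + 1 - I.card))
    else 0

/-- The indices `n_i > 1` of the variables that occur in a monomial, listed in increasing order
with multiplicity: `x^m = x₁^(m 1) x_{n₁} … x_{n_k}`. -/
def higherIndices (m : ℕ+ →₀ ℕ) : List ℕ+ :=
  ((Finsupp.toMultiset m).filter fun i => 1 < i).sort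

/-- The linear operator `S` on `ℚ[x₁, x₂, …]` given on monomials by
`(-1)^n S(x₁^[n] x_{n₁} … x_{n_k}) = fourierSum g n (n₁, …, n_k)`, for `n_i > 1`. -/
def fourier (g : ℕ) : Module.End ℚ V :=
  (MvPolynomial.basisMonomials ℕ+ ℚ).constr ℚ fun m =>
    ((-1 : ℚ) ^ (m 1) * ((m 1) ! : ℚ)) • fourierSum g (m 1) (higherIndices m).get

end

end JacTaut

/-!
The operators `D`, multiplication by `x_k` and `D_k` are all proportional to members of one family
`hamOp g a b`: the cases `(a, b) = (2, 0)`, `(0, k + 1)` and `(k, 0)`. For `a + b ≥ 2` this family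
satisfies the commutation relations of the Poisson bracket of the polynomials `t ^ b ξ ^ a`.

The relations are spanned by the `D ^ d F` with `F` a monomial of degree `> g`, since a monomial of
degree `g` other than `x₁ ^ g` lies in the image of `D` by an `sl₂` argument. Hence the bracket with
`D` shows that every `hamOp g a b` preserves the relations; for `a = 0` this says that they form an
ideal.

An Abel-type identity for sums over set partitions shows that
`S (x_{n₁} ⋯ x_{n_k}) = D'_{n₁} ⋯ D'_{n_k} x₁^[g]`, where `D'_n = D_{n + 1}` for `n ≥ 2` and
`D'_1 = D`. So `S (x_n F) = D'_n (S F)` already holds on `V`, which gives (c) once `S` is known to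
be invertible on the quotient. For that, by induction on `a` and on monomials,
`S ∘ hamOp g a b ≡ (-1) ^ a • hamOp g b a ∘ S` modulo the relations, as expected of a Fourier
transform, which exchanges `t` and `ξ` up to sign. This shows that `S` preserves the relations, and
together with `S (S 1) = (-1) ^ g` that `S ^ 4 ≡ 1`.
-/

namespace JacTaut

open MvPolynomial

noncomputable section

theorem diffOp_apply {k : ℕ} (c : (Fin k → ℕ+) → V) (F : V) :
    diffOp c F = ∑ᶠ n : Fin k → ℕ+, c n * partials (List.ofFn n) F := rfl

theorem diffOp_smul {k : ℕ} (r : ℚ) (c : (Fin k → ℕ+) → V) :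
    diffOp (fun n => r • c n) = r • diffOp c := by
  refine LinearMap.ext fun F => ?_
  rw [LinearMap.smul_apply, diffOp_apply, diffOp_apply, smul_finsum' r (finite_support_diffOp c F)]
  simp only [smul_mul_assoc]

theorem diffOp_succ {k : ℕ} (c : (Fin (k + 1) → ℕ+) → V) {F : V} {s : Finset ℕ+}
    (hs : F.vars ⊆ s) :
    diffOp c F = ∑ n ∈ s, diffOp (fun v : Fin k → ℕ+ => c (Fin.snoc v n)) (pderiv n F) := by
  let e := Fin.snocEquiv fun _ : Fin (k + 1) => ℕ+
  have hpartials (n : ℕ+) (v : Fin k → ℕ+) :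
      partials (List.ofFn (e (n, v))) F = partials (List.ofFn v) (pderiv n F) := by
    have hlist : List.ofFn (e (n, v)) = (List.ofFn v).concat n := by
      simp only [e, List.ofFn_succ', Fin.snocEquiv_apply, Fin.snoc_castSucc, Fin.snoc_last]
    rw [hlist, List.concat_eq_append]
    simp only [partials, List.map_append, List.prod_append, List.map_singleton,
      List.prod_singleton, Module.End.mul_apply, Derivation.coeFn_coe]
  have hvanish : (Function.support fun n : ℕ+ =>
      diffOp (fun v : Fin k → ℕ+ => c (Fin.snoc v n)) (pderiv n F)) ⊆ s := fun n hn =>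
    hs (not_imp_comm.mp pderiv_eq_zero_of_notMem_vars fun h => hn (by simp only [h, map_zero]))
  rw [← finsum_eq_sum_of_support_subset _ hvanish, diffOp_apply, ← finsum_comp_equiv e]
  refine (finsum_curry _ ((finite_support_diffOp c F).preimage e.injective.injOn)).trans ?_
  simp only [hpartials]
  rfl

/-- The operator
`∑ (n₁ + ⋯ + n_a + b)! / (n₁! ⋯ n_a!) x_{n₁ + ⋯ + n_a + b - 1} ∂_{n₁} ⋯ ∂_{n_a}`, which quantizes
the Hamiltonian `t ^ b ξ ^ a`. -/
def gen (a b : ℕ) : Module.End ℚ V :=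
  diffOp fun n : Fin a → ℕ+ =>
    ((((∑ i, (n i : ℕ)) + b)! : ℚ) / ∏ i, ((n i : ℕ)! : ℚ)) • x ((∑ i, (n i : ℕ)) + b - 1)

theorem x_coe (m : ℕ+) : x (m : ℕ) = X m := by simp [x]

theorem Dk_eq (k : ℕ) : Dk k = (1 / (k ! : ℚ)) • gen k 0 := by
  simp only [Dk, gen, add_zero]

theorem D_eq (g : ℕ) : D g = Dk 2 - (g : ℚ) • partialOne := by
  rw [D, Dk, neg_add_eq_sub]
  simp only [Nat.cast_add_choose, Fin.sum_univ_two, Fin.prod_univ_two, Nat.factorial_two,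
    Nat.cast_ofNat]

theorem gen_zero (b : ℕ) (F : V) : gen 0 b F = (b ! : ℚ) • (x (b - 1) * F) := by
  simp [gen, diffOp, partials, finsum_unique]

theorem gen_succ (a b : ℕ) {F : V} {s : Finset ℕ+} (hs : F.vars ⊆ s) :
    gen (a + 1) b F = ∑ n ∈ s, (1 / ((n : ℕ)! : ℚ)) • gen a (b + n) (pderiv n F) := by
  rw [gen, diffOp_succ _ hs]
  refine Finset.sum_congr rfl fun n _ => ?_
  rw [gen, ← LinearMap.smul_apply, ← diffOp_smul]
  congr! 3 with v
  simp only [Fin.sum_univ_castSucc, Fin.prod_univ_castSucc, Fin.snoc_castSucc, Fin.snoc_last,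
    smul_smul, add_assoc, add_comm (n : ℕ) b]
  congr 1
  field_simp

theorem gen_succ_one (a b : ℕ) : gen (a + 1) b 1 = 0 := by
  rw [gen_succ a b (s := ∅) (by simp), Finset.sum_empty]

theorem gen_X_mul (a b : ℕ) (m : ℕ+) (F : V) :
    gen a b (X m * F) = X m * gen a b F + (a / ((m : ℕ)! : ℚ)) • gen (a - 1) (b + m) F := by
  induction a generalizing b F with
  | zero => simp [gen_zero, mul_left_comm]
  | succ a ih =>
    have hF : F.vars ⊆ {m} ∪ F.vars := Finset.subset_union_right
    have hXF : (X m * F).vars ⊆ {m} ∪ F.vars := by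
      simpa only [vars_X] using vars_mul (X m) F
    have hlower : (a / ((m : ℕ)! : ℚ)) • gen a (b + m) F = ∑ n ∈ {m} ∪ F.vars,
        (1 / ((n : ℕ)! : ℚ)) • (a / ((m : ℕ)! : ℚ)) • gen (a - 1) (b + n + m) (pderiv n F) := by
      cases a with
      | zero => simp
      | succ a =>
        rw [gen_succ a (b + m) hF, Finset.smul_sum]
        exact Finset.sum_congr rfl fun n _ => by rw [smul_comm, add_right_comm]; rfl
    have hleibniz (n : ℕ+) : pderiv n (X m * F) = X m * pderiv n F + if n = m then F else 0 := by
      rw [Derivation.leibniz, pderiv_X, Pi.single_apply, smul_eq_mul, smul_eq_mul, mul_ite, mul_one,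
        mul_zero]
      simp only [eq_comm]
    rw [gen_succ a b hF, gen_succ a b hXF]
    simp only [hleibniz, map_add, ih, smul_add, Finset.sum_add_distrib, ← hlower]
    simp only [apply_ite, smul_zero, map_zero, Finset.sum_ite_eq', Finset.mem_union,
      Finset.mem_singleton, true_or, if_true, Finset.mul_sum, mul_smul_comm, Nat.add_sub_cancel,
      add_assoc, ← add_smul]
    congr 2
    push_cast
    ring

/-- The operators `gen a b`, corrected at `a + b = 2` so that `hamOp g 2 0 = 2 D`. For `2 ≤ a + b`
they represent the Lie algebra of polynomial Hamiltonians `t ^ b ξ ^ a` on the plane, without any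
quantum correction to the Poisson bracket, see `hamOp_hamOp`. -/
def hamOp (g a b : ℕ) : Module.End ℚ V :=
  gen a b - if a + b = 2 then (a * g : ℚ) • partialOne ^ (a - 1) else 0

theorem hamOp_of_three_le (g : ℕ) {a b : ℕ} (h : 3 ≤ a + b) : hamOp g a b = gen a b := by
  rw [hamOp, if_neg (by omega), sub_zero]

theorem hamOp_zero_apply (g : ℕ) (m : ℕ+) (F : V) :
    hamOp g 0 (m + 1) F = ((m + 1)! : ℚ) • (X m * F) := by
  simp [hamOp, gen_zero, x_coe]

theorem D_eq_hamOp (g : ℕ) : D g = (1 / 2 : ℚ) • hamOp g 2 0 := by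
  rw [D_eq, Dk_eq, hamOp, if_pos rfl, smul_sub, smul_smul]
  congr 2
  simp

theorem hamOp_succ_one (g a b : ℕ) :
    hamOp g (a + 1) b 1 = (if a = 0 ∧ b = 1 then -(g : ℚ) else 0) • (1 : V) := by
  rw [hamOp, LinearMap.sub_apply, gen_succ_one]
  split_ifs with h h' h'
  · obtain ⟨rfl, rfl⟩ := h'
    simp
  · obtain ⟨a, rfl⟩ := Nat.exists_eq_succ_of_ne_zero (show a ≠ 0 by omega)
    simp [pow_succ, partialOne]
  · omega
  · simp

theorem hamOp_X_mul (g : ℕ) {a b : ℕ} (h : 2 ≤ a + b) (m : ℕ+) (F : V) :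
    hamOp g a b (X m * F) = X m * hamOp g a b F +
      (a / ((m : ℕ)! : ℚ)) • hamOp g (a - 1) (b + m) F := by
  have hgen := gen_X_mul a b m F
  obtain rfl | ha := Nat.eq_zero_or_pos a
  · simpa [hamOp] using hgen
  obtain h | h := h.lt_or_eq
  · rw [hamOp_of_three_le g h, hamOp_of_three_le g (by have := m.pos; omega), hgen]
  have hpartial : partialOne (X m * F) = X m * partialOne F + if m = 1 then F else 0 := by
    simp [partialOne, pderiv_X, Pi.single_apply, mul_comm, add_comm]
  obtain ⟨rfl, rfl⟩ | ⟨rfl, rfl⟩ : a = 1 ∧ b = 1 ∨ a = 2 ∧ b = 0 := by omega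
  · simp only [hamOp, hgen, LinearMap.sub_apply, Nat.sub_self, pow_zero, CharP.cast_eq_zero,
      zero_mul, zero_smul, ite_self, LinearMap.zero_apply, if_true, LinearMap.smul_apply,
      Module.End.one_apply, mul_sub, mul_smul_comm]
    module
  · obtain rfl | hm := eq_or_ne m 1
    · simp only [hamOp, hgen, hpartial, LinearMap.sub_apply, add_zero, if_true, zero_add,
        Nat.reduceSub, pow_one, pow_zero, LinearMap.smul_apply, Module.End.one_apply, PNat.one_coe,
        Nat.reduceAdd, mul_sub, mul_smul_comm, Nat.factorial_one, Nat.cast_one, Nat.cast_ofNat]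
      module
    · have hm' : 1 + (m : ℕ) ≠ 2 := fun h => hm (PNat.coe_eq_one_iff.mp (by omega))
      simp only [hamOp, hgen, hpartial, LinearMap.sub_apply, add_zero, if_true,
        if_neg hm, if_neg hm', zero_add, Nat.reduceSub, pow_one, LinearMap.smul_apply, sub_zero,
        mul_sub, mul_smul_comm]
      module

theorem induction_X_mul {P : V → Prop} (one : P 1) (add : ∀ F G, P F → P G → P (F + G))
    (smul : ∀ (r : ℚ) F, P F → P (r • F)) (X_mul : ∀ m F, P F → P (X m * F)) (F : V) : P F := by
  induction F using MvPolynomial.induction_on with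
  | C r => simpa only [smul_eq_C_mul, mul_one] using smul r 1 one
  | add F G hF hG => exact add F G hF hG
  | mul_X F m hF => simpa only [mul_comm] using X_mul m F hF

theorem D_X_mul (g : ℕ) (m : ℕ+) (F : V) :
    D g (X m * F) = X m * D g F + (1 / ((m : ℕ)! : ℚ)) • hamOp g 1 m F := by
  rw [D_eq_hamOp, LinearMap.smul_apply, LinearMap.smul_apply, hamOp_X_mul g (a := 2) le_rfl,
    zero_add, smul_add, smul_smul, mul_smul_comm]
  congr 2
  push_cast
  ring

theorem hamOp_hamOp_zero (g : ℕ) {a b d : ℕ} (hab : 2 ≤ a + b) (hd : 2 ≤ d) (F : V) :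
    hamOp g a b (hamOp g 0 d F) =
      hamOp g 0 d (hamOp g a b F) + (a * d : ℚ) • hamOp g (a - 1) (b + d - 1) F := by
  obtain ⟨m, rfl⟩ : ∃ m : ℕ+, d = m + 1 := ⟨⟨d - 1, by omega⟩, by simp; omega⟩
  rw [hamOp_zero_apply, hamOp_zero_apply, map_smul, hamOp_X_mul g hab, smul_add, smul_smul,
    Nat.factorial_succ, ← add_assoc b, Nat.add_sub_cancel]
  congr 2
  push_cast
  field_simp

theorem hamOp_hamOp_one (g : ℕ) {a b c d : ℕ} (hab : 2 ≤ a + 1 + b) (hcd : 2 ≤ c + 1 + d) :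
    hamOp g (a + 1) b (hamOp g (c + 1) d 1) = hamOp g (c + 1) d (hamOp g (a + 1) b 1) +
      ((a + 1 : ℕ) * d - b * (c + 1 : ℕ) : ℚ) • hamOp g (a + 1 + (c + 1) - 1) (b + d - 1) 1 := by
  have hbracket : ((a + 1 : ℕ) * d - b * (c + 1 : ℕ) : ℚ) •
      hamOp g (a + 1 + (c + 1) - 1) (b + d - 1) 1 = 0 := by
    rw [show a + 1 + (c + 1) - 1 = a + c + 1 by omega, hamOp_succ_one]
    split_ifs with h
    · obtain ⟨rfl, rfl, rfl, rfl⟩ : a = 0 ∧ c = 0 ∧ b = 1 ∧ d = 1 := by omega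
      simp
    · simp
  rw [hbracket, add_zero, hamOp_succ_one, hamOp_succ_one, map_smul, map_smul, hamOp_succ_one,
    hamOp_succ_one, smul_comm]

theorem hamOp_hamOp (g : ℕ) {a b c d : ℕ} (hab : 2 ≤ a + b) (hcd : 2 ≤ c + d) (F : V) :
    hamOp g a b (hamOp g c d F) = hamOp g c d (hamOp g a b F) +
      (a * d - b * c : ℚ) • hamOp g (a + c - 1) (b + d - 1) F := by
  induction hn : a + c using Nat.strong_induction_on generalizing a b c d F with
  | _ n ih =>
  subst hn
  rcases c with _ | c
  · simpa using hamOp_hamOp_zero g hab (by omega : 2 ≤ d) F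
  rcases a with _ | a
  · rw [hamOp_hamOp_zero g hcd (by omega : 2 ≤ b), add_comm d b, zero_add]
    push_cast
    module
  induction F using induction_X_mul with
  | one => exact hamOp_hamOp_one g hab hcd
  | add F G hF hG =>
    simp only [map_add, hF, hG]
    module
  | smul r F hF =>
    simp only [map_smul, hF]
    module
  | X_mul m F hF =>
    have hm := m.pos
    have hleft := ih (a + 1 + c) (by omega) hab (by omega : 2 ≤ c + (d + m)) F rfl
    have hright := ih (c + 1 + a) (by omega) hcd (by omega : 2 ≤ a + (b + m)) F rfl
    have hindex : ((a + 1 : ℕ) * d - b * (c + 1 : ℕ) : ℚ) • hamOp g (a + c) (b + d - 1 + m) F =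
        ((a + 1 : ℕ) * d - b * (c + 1 : ℕ) : ℚ) • hamOp g (a + c) (b + d + m - 1) F := by
      obtain h | h := Nat.eq_zero_or_pos (b + d)
      · simp [show b = 0 by omega, show d = 0 by omega]
      · rw [Nat.sub_add_comm h]
    rw [show a + 1 + c - 1 = a + c by omega, show b + (d + m) - 1 = b + d + m - 1 by omega] at hleft
    rw [show c + 1 + a - 1 = a + c by omega, show d + (b + m) - 1 = b + d + m - 1 by omega]
      at hright
    rw [show a + 1 + (c + 1) - 1 = a + c + 1 by omega] at hF ⊢
    simp only [hamOp_X_mul g hab, hamOp_X_mul g hcd,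
      hamOp_X_mul g (show 2 ≤ a + c + 1 + (b + d - 1) by omega), map_add, map_smul, hF,
      Nat.add_sub_cancel, hleft, hright, smul_add,
      smul_comm _ (_ / _) (hamOp _ _ (_ + _) _), hindex]
    push_cast
    simp only [mul_add, mul_smul_comm]
    module

/-- The bigrading of `V` by the degree and by the number of factors of a monomial. Its values are
integers because the operators `hamOp` lower both. -/
def bideg : ℕ+ → ℤ × ℤ := fun n => (n, 1)

/-- The polynomial `F` is a combination of products of `r` variables, of total degree `p`. -/
abbrev IsBihomogeneous (F : V) (p r : ℤ) : Prop := IsWeightedHomogeneous bideg F (p, r)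

theorem weight_bideg (m : ℕ+ →₀ ℕ) :
    Finsupp.weight bideg m = (↑(Finsupp.weight deg m), (m.degree : ℤ)) := by
  simp [Finsupp.weight_apply, Finsupp.sum, bideg, deg, Finsupp.degree_apply, Prod.ext_iff,
    Prod.fst_sum, Prod.snd_sum]

theorem isBihomogeneous_monomial (m : ℕ+ →₀ ℕ) (r : ℚ) :
    IsBihomogeneous (monomial m r) (Finsupp.weight deg m) m.degree :=
  isWeightedHomogeneous_monomial _ _ _ (weight_bideg m)

theorem IsBihomogeneous.isWeightedHomogeneous_deg {F : V} {n : ℕ} {r : ℤ}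
    (hF : IsBihomogeneous F n r) : IsWeightedHomogeneous deg F n := fun m hm => by
  have h := hF hm
  rw [weight_bideg, Prod.mk.injEq] at h
  exact_mod_cast h.1

theorem IsBihomogeneous.congr {F : V} {p r p' r' : ℤ} (hF : IsBihomogeneous F p r)
    (hp : p = p') (hr : r = r') : IsBihomogeneous F p' r' :=
  hp ▸ hr ▸ hF

protected theorem IsBihomogeneous.X_mul {F : V} {p r : ℤ} (hF : IsBihomogeneous F p r) (m : ℕ+) :
    IsBihomogeneous (X m * F) (p + m) (r + 1) := by
  have h := (isWeightedHomogeneous_X ℚ bideg m).mul hF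
  rwa [bideg, Prod.mk_add_mk, add_comm, add_comm 1] at h

protected theorem IsBihomogeneous.smul {F : V} {p r : ℤ} (hF : IsBihomogeneous F p r) (c : ℚ) :
    IsBihomogeneous (c • F) p r :=
  (weightedHomogeneousSubmodule ℚ bideg (p, r)).smul_mem c hF

protected theorem IsBihomogeneous.pderiv {F : V} {p r : ℤ} (hF : IsBihomogeneous F p r) (n : ℕ+) :
    IsBihomogeneous (pderiv n F) (p - n) (r - 1) :=
  IsWeightedHomogeneous.pderiv hF (by simp [bideg])

protected theorem IsBihomogeneous.gen {F : V} {p r : ℤ} (hF : IsBihomogeneous F p r) {a b : ℕ}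
    (h : 2 ≤ a + b) : IsBihomogeneous (gen a b F) (p + b - 1) (r + 1 - a) := by
  induction a generalizing b p r F with
  | zero =>
    obtain ⟨m, rfl⟩ : ∃ m : ℕ+, b = m + 1 := ⟨⟨b - 1, by omega⟩, by simp; omega⟩
    rw [gen_zero, Nat.add_sub_cancel, x_coe]
    exact ((hF.X_mul m).smul _).congr (by push_cast; ring) (by simp)
  | succ a ih =>
    rw [gen_succ a b subset_rfl]
    refine IsWeightedHomogeneous.sum _ _ _ fun n _ => ?_
    exact ((ih (hF.pderiv n) (by have := n.pos; omega)).smul _).congr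
      (by push_cast; ring) (by push_cast; ring)

protected theorem IsBihomogeneous.hamOp {F : V} {p r : ℤ} (hF : IsBihomogeneous F p r)
    (g : ℕ) {a b : ℕ} (h : 2 ≤ a + b) :
    IsBihomogeneous (hamOp g a b F) (p + b - 1) (r + 1 - a) := by
  obtain h' | h' := h.lt_or_eq
  · rw [hamOp_of_three_le g h']
    exact hF.gen h
  rw [JacTaut.hamOp, if_pos h'.symm]
  refine (hF.gen h).sub ?_
  obtain ⟨rfl, rfl⟩ | ⟨rfl, rfl⟩ | ⟨rfl, rfl⟩ :
    a = 0 ∧ b = 2 ∨ a = 1 ∧ b = 1 ∨ a = 2 ∧ b = 0 := by omega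
  · simpa using isWeightedHomogeneous_zero ℚ bideg _
  · simpa using hF.smul _
  · exact ((hF.pderiv 1).smul _).congr (by simp) (by push_cast; ring)

protected theorem IsBihomogeneous.D {F : V} {p r : ℤ} (hF : IsBihomogeneous F p r) (g : ℕ) :
    IsBihomogeneous (D g F) (p - 1) (r - 1) := by
  rw [D_eq_hamOp]
  exact ((hF.hamOp g (a := 2) le_rfl).smul _).congr (by simp) (by push_cast; ring)

protected theorem IsBihomogeneous.D_pow {F : V} {p r : ℤ} (hF : IsBihomogeneous F p r)
    (g d : ℕ) : IsBihomogeneous ((JacTaut.D g ^ d) F) (p - d) (r - d) := by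
  induction d with
  | zero => simpa using hF
  | succ d ih =>
    rw [pow_succ', Module.End.mul_apply]
    exact (ih.D g).congr (by push_cast; ring) (by push_cast; ring)

theorem hamOp_one_one_monomial (g : ℕ) (m : ℕ+ →₀ ℕ) (c : ℚ) :
    hamOp g 1 1 (monomial m c) = (Finsupp.weight deg m + m.degree - g : ℚ) • monomial m c := by
  have hvars : (monomial m c).vars ⊆ m.support := by
    obtain rfl | hc := eq_or_ne c 0
    · simp
    · rw [vars_monomial hc]
  have heuler (n : ℕ+) : (1 / ((n : ℕ)! : ℚ)) • gen 0 (1 + n) (pderiv n (monomial m c)) =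
      ((n + 1) * m n : ℚ) • monomial m c := by
    rw [gen_zero, Nat.add_sub_cancel_left, x_coe, X_mul_pderiv_monomial, add_comm,
      Nat.factorial_succ, ← Nat.cast_smul_eq_nsmul ℚ, smul_smul, smul_smul]
    congr 1
    push_cast
    field_simp
  rw [hamOp, if_pos rfl, LinearMap.sub_apply, gen_succ 0 1 hvars, Finset.sum_congr rfl
    fun n _ => heuler n, ← Finset.sum_smul, Nat.sub_self, pow_zero, LinearMap.smul_apply,
    Module.End.one_apply, ← sub_smul, Nat.cast_one, one_mul, Finsupp.weight_apply,
    Finsupp.degree_apply, Finsupp.sum]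
  push_cast
  simp only [smul_eq_mul, deg, ← Finset.sum_add_distrib]
  congr! 3
  push_cast
  ring

theorem hamOp_one_one_apply (g : ℕ) {F : V} {p r : ℤ} (hF : IsBihomogeneous F p r) :
    hamOp g 1 1 F = (p + r - g : ℚ) • F := by
  induction hF using IsWeightedHomogeneous.induction_on with
  | zero => simp
  | add F G _ _ hF hG => rw [map_add, hF, hG, smul_add]
  | monomial m c hm =>
    rw [weight_bideg, Prod.mk.injEq] at hm
    rw [hamOp_one_one_monomial, ← hm.1, ← hm.2, Int.cast_natCast, Int.cast_natCast]

/-- The ideal generated by the variables `x_n` with `n > 1`. -/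
def higher : Ideal V := Ideal.span (X '' {n | n ≠ 1})

theorem mem_higher_iff {F : V} : F ∈ higher ↔ ∀ m ∈ F.support, ∃ n ≠ 1, m n ≠ 0 :=
  mem_ideal_span_X_image

theorem X_mem_higher {n : ℕ+} (hn : n ≠ 1) : (X n : V) ∈ higher :=
  Ideal.subset_span ⟨n, hn, rfl⟩

theorem gen_mem_higher {a b : ℕ} (h : 3 ≤ a + b) (F : V) : gen a b F ∈ higher := by
  induction a generalizing b F with
  | zero =>
    obtain ⟨m, rfl⟩ : ∃ m : ℕ+, b = m + 1 := ⟨⟨b - 1, by omega⟩, by simp; omega⟩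
    have hm : m ≠ 1 := by
      rintro rfl
      simp at h
    rw [gen_zero, Nat.add_sub_cancel, x_coe]
    exact Submodule.smul_of_tower_mem _ _ (Ideal.mul_mem_right _ _ (X_mem_higher hm))
  | succ a ih =>
    rw [gen_succ a b subset_rfl]
    exact Submodule.sum_mem _ fun n _ =>
      Submodule.smul_of_tower_mem _ _ (ih (by have := n.pos; omega) _)

theorem D_mem_higher (g : ℕ) {F : V} (hF : F ∈ higher) : D g F ∈ higher := by
  induction hF using Submodule.closure_induction with
  | zero => simp
  | add F G _ _ hF hG => simpa using add_mem hF hG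
  | smul_mem F G hG =>
    obtain ⟨n, hn, rfl⟩ := hG
    have hn' : (n : ℕ) ≠ 1 := mt PNat.coe_eq_one_iff.mp hn
    have hn3 : 3 ≤ 1 + (n : ℕ) := by
      have := n.pos
      omega
    rw [smul_eq_mul, mul_comm, D_X_mul, hamOp_of_three_le g hn3]
    exact add_mem (Ideal.mul_mem_right _ _ (X_mem_higher hn))
      (Submodule.smul_of_tower_mem _ _ (gen_mem_higher hn3 F))

theorem IsBihomogeneous.eq_zero_of_mem_higher {F : V} {p : ℤ} (hF : IsBihomogeneous F p 0)
    (h : F ∈ higher) : F = 0 := by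
  by_contra hne
  obtain ⟨m, hm⟩ := ne_zero_iff.mp hne
  obtain ⟨n, -, hn⟩ := mem_higher_iff.mp h m (mem_support_iff.mpr hm)
  have hw := hF hm
  rw [weight_bideg, Prod.mk.injEq, Nat.cast_eq_zero,
    Finsupp.degree_eq_zero_iff] at hw
  simp [hw.2] at hn

theorem apply_one_lt_weight_iff {m : ℕ+ →₀ ℕ} :
    m 1 < Finsupp.weight deg m ↔ ∃ n ≠ 1, m n ≠ 0 := by
  have hsplit : Finsupp.weight deg m = m 1 + Finsupp.weight deg (m.erase 1) := by
    conv_lhs => rw [← Finsupp.single_add_erase 1 m, map_add, Finsupp.weight_single]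
    simp [deg]
  have hdeg : NonTorsionWeight deg := nonTorsionWeight_of fun n => n.ne_zero
  rw [hsplit, lt_add_iff_pos_right, Nat.pos_iff_ne_zero, ne_eq, weightedDegree_eq_zero_iff hdeg,
    not_forall]
  refine exists_congr fun n => ?_
  obtain rfl | hn := eq_or_ne n 1
  · simp
  · simp [hn, Finsupp.erase_ne hn]

theorem IsBihomogeneous.X_one_pow_mul {F : V} {p r : ℤ} (hF : IsBihomogeneous F p r) (j : ℕ) :
    IsBihomogeneous (X 1 ^ j * F) (p + j) (r + j) := by
  induction j with
  | zero => simpa using hF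
  | succ j ih =>
    rw [pow_succ', mul_assoc]
    exact (ih.X_mul 1).congr (by simp [add_assoc]) (by simp [add_assoc])

theorem D_X_one_pow_mul (g j : ℕ) {F : V} {p r : ℤ} (hF : IsBihomogeneous F p r) :
    D g (X 1 ^ (j + 1) * F) = X 1 ^ (j + 1) * D g F +
      ((j + 1) * (p + r - g + j) : ℚ) • (X 1 ^ j * F) := by
  have hX (G : V) : D g (X 1 * G) = X 1 * D g G + hamOp g 1 1 G := by simpa using D_X_mul g 1 G
  induction j with
  | zero => simp [hX, hamOp_one_one_apply g hF]
  | succ j ih =>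
    rw [pow_succ', mul_assoc, hX, ih, hamOp_one_one_apply g (hF.X_one_pow_mul (j + 1))]
    simp only [mul_add, mul_smul_comm, ← mul_assoc, ← pow_succ']
    push_cast
    module

theorem D_pow_mem_higher (g d : ℕ) {F : V} (hF : F ∈ higher) : (D g ^ d) F ∈ higher := by
  induction d with
  | zero => simpa using hF
  | succ d ih =>
    rw [pow_succ', Module.End.mul_apply]
    exact D_mem_higher g ih

-- Since `D (X₁ ^ (j + 1) D ^ j F) - X₁ ^ (j + 1) D ^ (j + 1) F` is a nonzero multiple of
-- `X₁ ^ j D ^ j F` for `j < r`, a descending induction starts from `D ^ r F = 0`.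
theorem IsBihomogeneous.mem_map_D {g r : ℕ} {F : V} (hF : IsBihomogeneous F g r)
    (hF' : F ∈ higher) : F ∈ (weightedHomogeneousSubmodule ℚ deg (g + 1)).map (JacTaut.D g) := by
  set W := (weightedHomogeneousSubmodule ℚ deg (g + 1)).map (JacTaut.D g)
  suffices h : ∀ j ≤ r, X 1 ^ j * (JacTaut.D g ^ j) F ∈ W by simpa using h 0 r.zero_le
  intro j hj
  induction hj using Nat.decreasingInduction with
  | self =>
    have hr : (JacTaut.D g ^ r) F = 0 :=
      ((hF.D_pow g r).congr rfl (sub_self _)).eq_zero_of_mem_higher (D_pow_mem_higher g r hF')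
    simp [hr]
  | of_succ j hj ih =>
    have hj' := hF.D_pow g j
    have hW : JacTaut.D g (X 1 ^ (j + 1) * (JacTaut.D g ^ j) F) ∈ W :=
      Submodule.mem_map_of_mem ((hj'.X_one_pow_mul (j + 1)).congr (p' := (g + 1 : ℕ))
        (by push_cast; ring) rfl).isWeightedHomogeneous_deg
    have hc : ((j + 1) * ((g - j : ℤ) + (r - j : ℤ) - g + j) : ℚ) ≠ 0 := by
      push_cast
      rw [show ((j + 1) * (g - j + (r - j) - g + j) : ℚ) = (j + 1) * (r - j) by ring]
      have : (j : ℚ) < r := mod_cast hj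
      exact mul_ne_zero (by positivity) (by linarith)
    rw [D_X_one_pow_mul g j hj'] at hW
    rw [← Module.End.mul_apply, ← pow_succ'] at hW
    exact (W.smul_mem_iff hc).mp ((W.add_mem_iff_right ih).mp hW)

theorem monomial_mem_higher_iff {m : ℕ+ →₀ ℕ} :
    (monomial m 1 : V) ∈ higher ↔ m 1 < Finsupp.weight deg m := by
  rw [mem_higher_iff, apply_one_lt_weight_iff, support_monomial, if_neg one_ne_zero]
  simp

theorem mem_relations_of_lt {g n : ℕ} (h : g < n) {F : V} (hF : IsWeightedHomogeneous deg F n) :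
    F ∈ relations g :=
  Submodule.subset_span (Or.inl ⟨n, h, hF⟩)

theorem mem_relations_of_mem_higher {g : ℕ} {F : V} (hF : IsWeightedHomogeneous deg F g)
    (hF' : F ∈ higher) : F ∈ relations g := by
  rw [F.as_sum]
  refine Submodule.sum_mem _ fun m hm => ?_
  rw [← mul_one (coeff m F), ← smul_eq_mul, ← smul_monomial]
  refine Submodule.smul_mem _ _ (Submodule.subset_span (Or.inr ⟨0, m, ?_, ?_, by simp⟩))
  · exact hF (mem_support_iff.mp hm)
  · have hw := hF (mem_support_iff.mp hm)
    rw [← hw, apply_one_lt_weight_iff]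
    exact mem_higher_iff.mp hF' m hm

theorem D_X_one_pow_self (g : ℕ) : D g (X 1 ^ (g + 1)) = 0 := by
  have h := D_X_one_pow_mul g g (F := 1) (p := 0) (r := 0) (isWeightedHomogeneous_one ℚ bideg)
  have h1 : D g 1 = 0 := by simp [D_eq_hamOp, hamOp_succ_one g 1 0]
  simpa [h1] using h

theorem D_monomial_mem_relations {g : ℕ} {m : ℕ+ →₀ ℕ} (hm : g < Finsupp.weight deg m) :
    D g (monomial m 1) ∈ relations g := by
  have hD := (isBihomogeneous_monomial m 1).D g
  obtain hg | hg := (Nat.succ_le_iff.mpr hm).lt_or_eq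
  · refine mem_relations_of_lt (n := Finsupp.weight deg m - 1) (by omega)
      (hD.congr (p' := (Finsupp.weight deg m - 1 : ℕ)) (by omega) rfl).isWeightedHomogeneous_deg
  by_cases hm' : (monomial m 1 : V) ∈ higher
  · exact mem_relations_of_mem_higher
      (hD.congr (p' := g) (by omega) rfl).isWeightedHomogeneous_deg (D_mem_higher g hm')
  have hsingle : m = Finsupp.single 1 (m 1) := by
    ext n
    obtain rfl | hn := eq_or_ne n 1
    · simp
    · simpa [monomial_mem_higher_iff, apply_one_lt_weight_iff, hn] using mt (fun h => ⟨n, hn, h⟩)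
        (mt apply_one_lt_weight_iff.mpr (mt monomial_mem_higher_iff.mpr hm'))
  have hm1 : m 1 = g + 1 := by
    rw [hsingle] at hg
    simpa [Finsupp.weight_single, deg] using hg.symm
  rw [hsingle, ← X_pow_eq_monomial, hm1, D_X_one_pow_self]
  exact zero_mem _

theorem D_mem_relations {g : ℕ} {F : V} (hF : F ∈ relations g) : D g F ∈ relations g := by
  induction hF using Submodule.span_induction with
  | zero => simp
  | add F G _ _ hF hG => simpa using add_mem hF hG
  | smul c F _ hF => simpa using Submodule.smul_mem _ c hF
  | mem F hF =>
    obtain ⟨n, hn, hF⟩ | ⟨d, m, hm, hm1, rfl⟩ := hF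
    · induction hF using IsWeightedHomogeneous.induction_on with
      | zero => simp
      | add F G _ _ hF hG => simpa using add_mem hF hG
      | monomial m c hm =>
        rw [← mul_one c, ← smul_eq_mul, ← smul_monomial, map_smul]
        exact Submodule.smul_mem _ _ (D_monomial_mem_relations (hm.symm ▸ hn))
    · rw [← Module.End.mul_apply, ← pow_succ']
      exact Submodule.subset_span (Or.inr ⟨d + 1, m, hm, hm1, rfl⟩)

theorem D_pow_mem_relations {g : ℕ} (d : ℕ) {F : V} (hF : F ∈ relations g) :
    (D g ^ d) F ∈ relations g := by
  induction d with
  | zero => simpa using hF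
  | succ d ih =>
    rw [pow_succ', Module.End.mul_apply]
    exact D_mem_relations ih

theorem D_pow_mem_span {g n : ℕ} (d : ℕ) (hn : g < n) {F : V}
    (hF : IsWeightedHomogeneous deg F n) : (D g ^ d) F ∈ Submodule.span ℚ
      {F | ∃ d m, g < Finsupp.weight deg m ∧ F = (D g ^ d) (monomial m 1)} := by
  induction hF using IsWeightedHomogeneous.induction_on with
  | zero => simp
  | add F G _ _ hF hG => simpa using add_mem hF hG
  | monomial m c hm =>
    rw [← mul_one c, ← smul_eq_mul, ← smul_monomial, map_smul]
    exact Submodule.smul_mem _ _ (Submodule.subset_span ⟨d, m, hm.symm ▸ hn, rfl⟩)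

theorem relations_eq_span (g : ℕ) : relations g = Submodule.span ℚ
    {F | ∃ d m, g < Finsupp.weight deg m ∧ F = (D g ^ d) (monomial m 1)} := by
  refine le_antisymm (Submodule.span_le.mpr ?_) (Submodule.span_le.mpr ?_)
  · rintro F (⟨n, hn, hF⟩ | ⟨d, m, hm, hm1, rfl⟩)
    · exact D_pow_mem_span 0 hn hF
    · have hbi := isBihomogeneous_monomial m 1
      have hhigher : (monomial m 1 : V) ∈ higher := by rwa [monomial_mem_higher_iff, hm]
      rw [hm] at hbi
      obtain ⟨G, hG, hDG⟩ := hbi.mem_map_D hhigher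
      rw [← hDG, ← Module.End.mul_apply, ← pow_succ]
      exact D_pow_mem_span (d + 1) g.lt_succ_self hG
  · rintro _ ⟨d, m, hm, rfl⟩
    exact D_pow_mem_relations d (mem_relations_of_lt hm (isWeightedHomogeneous_monomial _ _ _ rfl))

theorem hamOp_D (g : ℕ) {a b : ℕ} (h : 2 ≤ a + b) (F : V) :
    hamOp g a b (D g F) = D g (hamOp g a b F) - (b : ℚ) • hamOp g (a + 1) (b - 1) F := by
  simp only [D_eq_hamOp, LinearMap.smul_apply, map_smul, hamOp_hamOp g h (le_refl (2 + 0)),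
    add_zero, show a + 2 - 1 = a + 1 by omega]
  push_cast
  module

theorem hamOp_monomial_mem_relations {g a b : ℕ} (h : 2 ≤ a + b) {m : ℕ+ →₀ ℕ}
    (hm : g < Finsupp.weight deg m) : hamOp g a b (monomial m 1) ∈ relations g := by
  have hbi := (isBihomogeneous_monomial m 1).hamOp g h
  obtain hg | hg := lt_or_ge g (Finsupp.weight deg m + b - 1)
  · have hbi := hbi.congr (p' := (Finsupp.weight deg m + b - 1 : ℕ)) (by omega) rfl
    exact mem_relations_of_lt hg hbi.isWeightedHomogeneous_deg
  obtain rfl : b = 0 := by omega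
  obtain ha | ha := h.lt_or_eq
  · rw [hamOp_of_three_le g ha] at hbi ⊢
    exact mem_relations_of_mem_higher (hbi.congr (by omega) rfl).isWeightedHomogeneous_deg
      (gen_mem_higher ha _)
  · have hD : hamOp g 2 0 = (2 : ℚ) • D g := by
      rw [D_eq_hamOp, smul_smul]
      norm_num
    rw [show a = 2 by omega, hD]
    exact Submodule.smul_mem _ _ (D_monomial_mem_relations hm)

theorem hamOp_mem_relations {g a b : ℕ} (h : 2 ≤ a + b) {F : V} (hF : F ∈ relations g) :
    hamOp g a b F ∈ relations g := by
  rw [relations_eq_span] at hF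
  induction hF using Submodule.span_induction with
  | zero => simp
  | add F G _ _ hF hG => simpa using add_mem hF hG
  | smul c F _ hF => simpa using Submodule.smul_mem _ c hF
  | mem F hF =>
    obtain ⟨d, m, hm, rfl⟩ := hF
    induction d generalizing a b with
    | zero => exact hamOp_monomial_mem_relations h hm
    | succ d ih =>
      rw [pow_succ', Module.End.mul_apply, hamOp_D g h]
      exact sub_mem (D_mem_relations (ih h)) (Submodule.smul_mem _ _ (ih (by omega)))

theorem mul_mem_relations {g : ℕ} (F : V) {G : V} (hG : G ∈ relations g) :
    F * G ∈ relations g := by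
  induction F using induction_X_mul with
  | one => simpa using hG
  | add F F' hF hF' => simpa only [add_mul] using add_mem hF hF'
  | smul r F hF => simpa only [smul_mul_assoc] using Submodule.smul_mem _ r hF
  | X_mul m F hF =>
    have hX := hamOp_mem_relations (g := g) (a := 0) (b := m + 1) (by have := m.pos; omega) hF
    rw [hamOp_zero_apply, Submodule.smul_mem_iff _ (by positivity)] at hX
    rwa [mul_assoc]

/-- The ideal `I_g`, whose underlying subspace is `relations g`. -/
def relationsIdeal (g : ℕ) : Ideal V where
  __ := relations g
  smul_mem' F _ hG := mul_mem_relations F hG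

theorem sup_erase_parts {ι : Type*} [DecidableEq ι] {s A : Finset ι} (P : Finpartition s)
    (hA : A ∈ P.parts) : (P.parts.erase A).sup id = s \ A := by
  have hsup : A ∪ (P.parts.erase A).sup id = s := by
    have := P.sup_parts
    rwa [← Finset.insert_erase hA, Finset.sup_insert] at this
  have hdisj : Disjoint A ((P.parts.erase A).sup id) :=
    P.supIndep (Finset.erase_subset _ _) hA (Finset.notMem_erase _ _)
  rw [← Finset.union_sdiff_cancel_left hdisj, hsup]

theorem parts_eq_of_insert_parts_eq {ι : Type*} [DecidableEq ι] {s A B : Finset ι} {c : ι}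
    (hc : c ∉ s) (hA : A ⊆ s) (hB : B ⊆ s) {Q : Finpartition (s \ A)} {R : Finpartition (s \ B)}
    (h : insert (insert c A) Q.parts = insert (insert c B) R.parts) :
    A = B ∧ Q.parts = R.parts := by
  have hQ {A : Finset ι} (Q : Finpartition (s \ A)) (B : Finset ι) : insert c B ∉ Q.parts :=
    fun h => hc (Finset.sdiff_subset (Q.subset h (B.mem_insert_self c)))
  have hins : insert c A = insert c B := by
    have := h ▸ Finset.mem_insert_self (insert c A) Q.parts
    exact (Finset.mem_insert.mp this).resolve_right (hQ R A)
  obtain rfl : A = B := by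
    rw [← Finset.erase_insert fun h => hc (hA h), hins, Finset.erase_insert fun h => hc (hB h)]
  exact ⟨rfl, by rw [← Finset.erase_insert (hQ Q A), h, Finset.erase_insert (hQ R A)]⟩

theorem sum_finpartition_insert {ι M : Type*} [DecidableEq ι] [AddCommMonoid M] {s : Finset ι}
    {c : ι} (hc : c ∉ s) (f : Finset (Finset ι) → M) :
    ∑ P : Finpartition (insert c s), f P.parts =
      ∑ A ∈ s.powerset, ∑ Q : Finpartition (s \ A), f (insert (insert c A) Q.parts) := by
  have hdisj (A : Finset ι) : Disjoint (s \ A) (insert c A) := by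
    simp [Finset.disjoint_insert_right, hc, Finset.sdiff_disjoint]
  have hunion {A : Finset ι} (hA : A ∈ s.powerset) : s \ A ⊔ insert c A = insert c s := by
    rw [Finset.sup_eq_union, Finset.union_insert,
      Finset.sdiff_union_of_subset (Finset.mem_powerset.mp hA)]
  rw [Finset.sum_sigma']
  symm
  refine Finset.sum_bij (fun p hp => p.2.extend (Finset.insert_ne_empty c p.1) (hdisj p.1)
    (hunion (Finset.mem_sigma.mp hp).1)) (fun _ _ => Finset.mem_univ _) ?_ ?_ (fun _ _ => rfl)
  · rintro ⟨A, Q⟩ hA ⟨B, R⟩ hB heq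
    obtain ⟨rfl, hQR⟩ := parts_eq_of_insert_parts_eq hc
      (Finset.mem_powerset.mp (Finset.mem_sigma.mp hA).1)
      (Finset.mem_powerset.mp (Finset.mem_sigma.mp hB).1) (congrArg Finpartition.parts heq)
    exact congrArg (Sigma.mk A) (Finpartition.ext hQR)
  · intro P _
    have hmem : P.part c ∈ P.parts := P.part_mem.mpr (s.mem_insert_self c)
    have hcP : c ∈ P.part c := P.mem_part_self.mpr (s.mem_insert_self c)
    have hsup : (P.parts.erase (P.part c)).sup id = s \ (P.part c).erase c := by
      rw [sup_erase_parts P hmem]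
      grind
    refine ⟨⟨(P.part c).erase c, P.ofSubset (Finset.erase_subset _ _) hsup⟩, ?_, ?_⟩
    · simpa [Finset.subset_insert_iff] using P.subset hmem
    · ext1
      simp [Finpartition.extend, Finpartition.ofSubset, Finset.insert_erase hcP,
        Finset.insert_erase hmem]

section Abel

open Finset

variable {ι M : Type*} [DecidableEq ι] [AddCommMonoid M]

theorem sum_powerset_sdiff (s : Finset ι) (f : Finset ι → Finset ι → M) :
    ∑ A ∈ s.powerset, f (s \ A) A = ∑ A ∈ s.powerset, f A (s \ A) := by
  refine sum_bij' (fun A _ => s \ A) (fun A _ => s \ A) ?_ ?_ ?_ ?_ ?_ <;>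
    simp +contextual

theorem sum_powerset_sum (s : Finset ι) (f : ι → Finset ι → Finset ι → M) :
    ∑ A ∈ s.powerset, ∑ a ∈ A, f a (A.erase a) (s \ A) =
      ∑ a ∈ s, ∑ A ∈ (s.erase a).powerset, f a A (s.erase a \ A) := by
  rw [sum_sigma', sum_sigma']
  refine sum_bij' (fun p _ => ⟨p.2, p.1.erase p.2⟩) (fun p _ => ⟨insert p.1 p.2, p.1⟩)
    ?_ ?_ ?_ ?_ ?_
  · simp only [mem_sigma, mem_powerset]
    grind
  · simp only [mem_sigma, mem_powerset]
    grind
  · simp only [mem_sigma, mem_powerset]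
    rintro ⟨A, a⟩ ⟨-, ha⟩
    rw [insert_erase ha]
  · simp only [mem_sigma, mem_powerset]
    rintro ⟨a, A⟩ ⟨-, hA⟩
    rw [erase_insert (fun h => notMem_erase a s (hA h))]
  · simp only [mem_sigma, mem_powerset]
    rintro ⟨A, a⟩ ⟨-, ha⟩
    congr 1
    grind

theorem sum_powerset_powerset_sdiff (s : Finset ι) (f : Finset ι → Finset ι → Finset ι → M) :
    ∑ A ∈ s.powerset, ∑ B ∈ (s \ A).powerset, f A B ((s \ A) \ B) =
      ∑ C ∈ s.powerset, ∑ B ∈ C.powerset, f (C \ B) B (s \ C) := by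
  rw [sum_sigma', sum_sigma']
  refine sum_bij' (fun p _ => ⟨p.1 ∪ p.2, p.2⟩) (fun p _ => ⟨p.1 \ p.2, p.2⟩) ?_ ?_ ?_ ?_ ?_
  all_goals
    simp only [mem_sigma, mem_powerset]
    rintro ⟨A, B⟩ ⟨hA, hB⟩
  · grind
  · grind
  · rw [union_sdiff_cancel_right (disjoint_sdiff.mono_right hB)]
  · rw [sdiff_union_of_subset hB]
  · rw [union_sdiff_cancel_right (disjoint_sdiff.mono_right hB), sdiff_sdiff_left, sup_eq_union]

theorem sum_powerset_powerset_comm (s : Finset ι) (f : Finset ι → Finset ι → M) :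
    ∑ A ∈ s.powerset, ∑ B ∈ (s \ A).powerset, f A B =
      ∑ B ∈ s.powerset, ∑ A ∈ (s \ B).powerset, f A B := by
  refine sum_comm' fun A B => ?_
  simp only [mem_powerset, subset_sdiff, disjoint_comm]
  tauto

theorem descFactorial_add_one (z k : ℕ) :
    (z + 1).descFactorial k = z.descFactorial k + k * z.descFactorial (k - 1) := by
  rcases k with _ | k
  · simp
  rw [Nat.succ_descFactorial_succ, Nat.descFactorial_succ, Nat.add_sub_cancel, ← add_mul]
  obtain h | h := lt_or_ge z k
  · simp [Nat.descFactorial_of_lt h]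
  · congr 1
    omega

/-- The sum of Hurwitz's binomial theorem, in terms of falling factorials. -/
def hurwitzSum (ν : ι → ℕ) (y w : ℕ) (s : Finset ι) : ℕ :=
  ∑ A ∈ s.powerset, (y + ∑ i ∈ A, ν i).descFactorial #A *
    (w + ∑ i ∈ s \ A, ν i).descFactorial #(s \ A)

theorem hurwitzSum_comm (ν : ι → ℕ) (y w : ℕ) (s : Finset ι) :
    hurwitzSum ν y w s = hurwitzSum ν w y s := by
  simp only [hurwitzSum, mul_comm ((y + _).descFactorial _)]
  exact sum_powerset_sdiff s fun A B =>
    (w + ∑ i ∈ A, ν i).descFactorial #A * (y + ∑ i ∈ B, ν i).descFactorial #B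

theorem hurwitzSum_add_one_left (ν : ι → ℕ) (y w : ℕ) (s : Finset ι) :
    hurwitzSum ν (y + 1) w s =
      hurwitzSum ν y w s + ∑ a ∈ s, hurwitzSum ν (y + ν a) w (s.erase a) := by
  have hsum := sum_powerset_sum s fun a A B => (y + ν a + ∑ i ∈ A, ν i).descFactorial #A *
    (w + ∑ i ∈ B, ν i).descFactorial #B
  simp only [hurwitzSum, ← hsum, ← sum_add_distrib]
  refine sum_congr rfl fun A _ => ?_
  have hA : ∑ a ∈ A, (y + ν a + ∑ i ∈ A.erase a, ν i).descFactorial #(A.erase a) =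
      #A * (y + ∑ i ∈ A, ν i).descFactorial (#A - 1) := by
    rw [← smul_eq_mul, ← sum_const]
    refine sum_congr rfl fun a ha => ?_
    rw [add_assoc, add_sum_erase A ν ha, card_erase_of_mem ha]
  rw [← sum_mul, hA, ← add_mul, ← descFactorial_add_one, add_right_comm]

theorem hurwitzSum_add_one_right (ν : ι → ℕ) (y w : ℕ) (s : Finset ι) :
    hurwitzSum ν y (w + 1) s =
      hurwitzSum ν y w s + ∑ a ∈ s, hurwitzSum ν y (w + ν a) (s.erase a) := by
  simp only [hurwitzSum_comm ν y, hurwitzSum_add_one_left]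

theorem hurwitzSum_add_right (ν : ι → ℕ) (y w n : ℕ) (s : Finset ι) :
    hurwitzSum ν y (w + n) s = hurwitzSum ν (y + n) w s := by
  induction s using Finset.strongInduction generalizing n with
  | H s ih =>
  induction n with
  | zero => rfl
  | succ n ihn =>
    rw [← add_assoc, ← add_assoc, hurwitzSum_add_one_right, hurwitzSum_add_one_left, ihn]
    congr 1
    refine sum_congr rfl fun a ha => ?_
    rw [add_assoc, add_assoc, ih _ (erase_ssubset ha)]

/-- The Abel polynomial `w (w + ν_A - 1) (w + ν_A - 2) ⋯ (w + ν_A - |A| + 1)`, where `ν_A` is the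
sum of `ν` over `A`. -/
def abelProd (ν : ι → ℕ) (w : ℕ) (A : Finset ι) : ℕ :=
  if A = ∅ then 1 else w * (w + ∑ i ∈ A, ν i - 1).descFactorial (#A - 1)

theorem abelProd_empty (ν : ι → ℕ) (w : ℕ) : abelProd ν w ∅ = 1 := if_pos rfl

theorem abelProd_insert (ν : ι → ℕ) (w : ℕ) {A : Finset ι} {a : ι} (ha : a ∉ A) :
    abelProd ν w (insert a A) = w * (w + (ν a + ∑ i ∈ A, ν i) - 1).descFactorial #A := by
  rw [abelProd, if_neg (insert_ne_empty a A), sum_insert ha, card_insert_of_notMem ha,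
    Nat.add_sub_cancel]

theorem descFactorial_card_eq_abelProd_add (ν : ι → ℕ) (w : ℕ) (A : Finset ι) :
    (w + ∑ i ∈ A, ν i).descFactorial #A = abelProd ν w A +
      ∑ a ∈ A, ν a * (w + ν a - 1 + ∑ i ∈ A.erase a, ν i).descFactorial #(A.erase a) := by
  obtain rfl | hA := A.eq_empty_or_nonempty
  · simp [abelProd_empty]
  have hsum : ∑ a ∈ A, ν a * (w + ν a - 1 + ∑ i ∈ A.erase a, ν i).descFactorial #(A.erase a) =
      (∑ a ∈ A, ν a) * (w + ∑ i ∈ A, ν i - 1).descFactorial (#A - 1) := by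
    rw [sum_mul]
    refine sum_congr rfl fun a ha => ?_
    obtain h | h := Nat.eq_zero_or_pos (ν a)
    · simp [h]
    · rw [← add_sum_erase A ν ha, card_erase_of_mem ha]
      congr 2
      omega
  rw [hsum, abelProd, if_neg hA.ne_empty, ← add_mul]
  obtain ⟨k, hk⟩ := Nat.exists_eq_succ_of_ne_zero hA.card_ne_zero
  obtain h | h := (w + ∑ i ∈ A, ν i).eq_zero_or_eq_succ_pred
  · simp [h, hk]
  · rw [hk, h, Nat.succ_descFactorial_succ]
    simp

theorem sum_abelProd_add (ν : ι → ℕ) (w y : ℕ) (s : Finset ι) :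
    ∑ A ∈ s.powerset, abelProd ν w A * (y + ∑ i ∈ s \ A, ν i).descFactorial #(s \ A) +
      ∑ a ∈ s, ν a * hurwitzSum ν (w + ν a - 1) y (s.erase a) = hurwitzSum ν w y s := by
  simp only [hurwitzSum, descFactorial_card_eq_abelProd_add ν w, add_mul, sum_add_distrib, mul_sum,
    sum_mul]
  congr 1
  have hsum := sum_powerset_sum s fun a A B => ν a *
    ((w + ν a - 1 + ∑ i ∈ A, ν i).descFactorial #A * (y + ∑ i ∈ B, ν i).descFactorial #B)
  simp only [hsum.symm, mul_assoc]

-- `hurwitzSum ν w y s` depends only on `w + y`, so by `sum_abelProd_add` the sum does not change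
-- when `(w, y)` is replaced by `(0, w + y)`, and then only `A = ∅` contributes.
theorem sum_abelProd_mul_descFactorial (ν : ι → ℕ) (w y : ℕ) (s : Finset ι) :
    ∑ A ∈ s.powerset, abelProd ν w A * (y + ∑ i ∈ s \ A, ν i).descFactorial #(s \ A) =
      (w + y + ∑ i ∈ s, ν i).descFactorial #s := by
  have hzero : ∑ A ∈ s.powerset,
      abelProd ν 0 A * (w + y + ∑ i ∈ s \ A, ν i).descFactorial #(s \ A) =
        (w + y + ∑ i ∈ s, ν i).descFactorial #s := by
    rw [sum_eq_single_of_mem ∅ (empty_mem_powerset s) fun A _ hA => by simp [abelProd, hA]]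
    simp [abelProd_empty]
  have hshift (a : ι) : ν a * hurwitzSum ν (w + ν a - 1) y (s.erase a) =
      ν a * hurwitzSum ν (0 + ν a - 1) (w + y) (s.erase a) := by
    obtain h | h := Nat.eq_zero_or_pos (ν a)
    · simp [h]
    · rw [add_comm w y, hurwitzSum_add_right]
      congr 2
      omega
  have hw := sum_abelProd_add ν w y s
  have h0 := sum_abelProd_add ν 0 (w + y) s
  rw [add_comm w y, hurwitzSum_add_right, zero_add, ← hw, add_comm y w, hzero] at h0
  simp only [hshift] at h0
  exact (Nat.add_right_cancel h0).symm

end Abel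

/-- The divided power `x₁^[c] = x₁^c / c!`, which is `0` for negative `c`. -/
def divPow (c : ℤ) : V :=
  if 0 ≤ c then (1 / (c.toNat ! : ℚ)) • X 1 ^ c.toNat else 0

theorem divPow_natCast (c : ℕ) : divPow c = (1 / (c ! : ℚ)) • X 1 ^ c := by simp [divPow]

theorem divPow_of_neg {c : ℤ} (h : c < 0) : divPow c = 0 := if_neg h.not_ge

theorem vars_divPow_subset (c : ℤ) : (divPow c).vars ⊆ {1} := by
  rw [divPow]
  split_ifs
  · rw [smul_eq_C_mul]
    exact (vars_mul _ _).trans (by simpa using vars_pow (X 1 : V) c.toNat)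
  · simp

theorem X_one_mul_divPow (c : ℤ) : X 1 * divPow c = (c + 1 : ℚ) • divPow (c + 1) := by
  obtain h | h := lt_or_ge c 0
  · obtain rfl | hc := eq_or_ne c (-1)
    · simp [divPow_of_neg]
    · rw [divPow_of_neg h, divPow_of_neg (by omega), mul_zero, smul_zero]
  · lift c to ℕ using h
    rw [← Nat.cast_succ, divPow_natCast, divPow_natCast, mul_smul_comm, ← pow_succ', smul_smul,
      Nat.factorial_succ]
    congr 1
    push_cast
    field_simp

theorem pderiv_one_divPow (c : ℤ) : pderiv 1 (divPow c) = divPow (c - 1) := by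
  obtain h | h | h := lt_trichotomy c 0
  · rw [divPow_of_neg h, divPow_of_neg (by omega), map_zero]
  · simp [h, divPow]
  · obtain ⟨n, rfl⟩ : ∃ n : ℕ, c = (n + 1 : ℕ) := ⟨(c - 1).toNat, by omega⟩
    rw [Nat.cast_succ, add_sub_cancel_right, ← Nat.cast_succ, divPow_natCast, divPow_natCast,
      Derivation.map_smul, pderiv_pow, pderiv_X_self, mul_one, Nat.succ_sub_one,
      Nat.factorial_succ, ← nsmul_eq_mul, ← Nat.cast_smul_eq_nsmul ℚ, smul_smul]
    congr 1
    push_cast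
    field_simp

theorem gen_divPow (a b : ℕ) (c : ℤ) :
    gen a b (divPow c) = ((a + b)! : ℚ) • (x (a + b - 1) * divPow (c - a)) := by
  induction a generalizing b c with
  | zero => simp [gen_zero]
  | succ a ih =>
    rw [gen_succ a b (vars_divPow_subset c), Finset.sum_singleton, pderiv_one_divPow, ih]
    rw [PNat.one_coe, Nat.factorial_one, Nat.cast_one, div_one, one_smul, sub_sub, Nat.cast_succ,
      add_comm (1 : ℤ), add_right_comm a 1 b, add_assoc a b 1]

theorem D_divPow (g : ℕ) (c : ℤ) : D g (divPow c) = (c - 1 - g : ℚ) • divPow (c - 1) := by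
  have hgen : gen 2 0 (divPow c) = (2 * (c - 1) : ℚ) • divPow (c - 1) := by
    have hX := X_one_mul_divPow (c - 2)
    rw [show c - 2 + 1 = c - 1 by ring] at hX
    rw [gen_divPow, show x (2 + 0 - 1) = X 1 from x_coe 1, Nat.cast_ofNat, hX, smul_smul]
    congr 1
    norm_num
    ring
  rw [D_eq, Dk_eq, LinearMap.sub_apply, LinearMap.smul_apply, LinearMap.smul_apply, hgen,
    show partialOne (divPow c) = divPow (c - 1) from pderiv_one_divPow c, Nat.factorial_two]
  push_cast
  module

theorem D_pow_divPow (g n : ℕ) :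
    (D g ^ n) (divPow g) = ((-1) ^ n * n ! : ℚ) • divPow (g - n) := by
  induction n with
  | zero => simp
  | succ n ih =>
    rw [pow_succ', Module.End.mul_apply, ih, map_smul, D_divPow, smul_smul, Nat.factorial_succ,
      show (g : ℤ) - n - 1 = g - (n + 1 : ℕ) by push_cast; ring]
    congr 1
    push_cast
    ring

section PartitionSum

open Finset

variable {ι : Type*}

/-- The factor `b(I) x_{d(I)}` of a block `I` in the formula for the Fourier transform. -/
def block (ν : ι → ℕ+) (I : Finset ι) : V :=
  (((∑ i ∈ I, (ν i : ℕ))! : ℚ) / ∏ i ∈ I, ((ν i : ℕ)! : ℚ)) • x (∑ i ∈ I, (ν i : ℕ) + 1 - #I)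

theorem card_le_sum (ν : ι → ℕ+) (s : Finset ι) : #s ≤ ∑ i ∈ s, (ν i : ℕ) := by
  simpa using card_nsmul_le_sum s (fun i => (ν i : ℕ)) 1 fun i _ => (ν i).pos

variable [DecidableEq ι]

/-- The sum over the partitions of `s` in the formula for the Fourier transform, with an arbitrary
integer `c` in place of `g - n`. -/
def partitionSum (ν : ι → ℕ+) (c : ℤ) (s : Finset ι) : V :=
  ∑ P : Finpartition s, divPow (c - #P.parts - ∑ i ∈ s, (ν i : ℕ)) * ∏ I ∈ P.parts, block ν I

theorem partitionSum_empty (ν : ι → ℕ+) (c : ℤ) : partitionSum ν c ∅ = divPow c := by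
  have hunique (P : Finpartition (∅ : Finset ι)) : P = Finpartition.empty (Finset ι) :=
    Subsingleton.elim (α := Finpartition (⊥ : Finset ι)) P _
  rw [partitionSum, Fintype.sum_eq_single _ fun P hP => absurd (hunique P) hP]
  simp

theorem partitionSum_insert (ν : ι → ℕ+) (c : ℤ) {s : Finset ι} {i : ι} (hi : i ∉ s) :
    partitionSum ν c (insert i s) = ∑ A ∈ s.powerset, block ν (insert i A) *
      partitionSum ν (c - 1 - ν i - ∑ j ∈ A, (ν j : ℕ)) (s \ A) := by
  rw [partitionSum, sum_finpartition_insert hi fun π =>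
    divPow (c - #π - ∑ j ∈ insert i s, (ν j : ℕ)) * ∏ I ∈ π, block ν I]
  refine sum_congr rfl fun A hA => ?_
  rw [partitionSum, mul_sum]
  refine sum_congr rfl fun P _ => ?_
  have hP : insert i A ∉ P.parts :=
    fun h => hi (sdiff_subset (P.subset h (mem_insert_self i A)))
  rw [prod_insert hP, card_insert_of_notMem hP, sum_insert hi, ← sum_sdiff (mem_powerset.mp hA),
    mul_left_comm]
  congr 3
  push_cast
  ring

end PartitionSum

section PartitionSum

open Finset

variable {ι : Type*}

theorem gen_block_mul (a b : ℕ) (ν : ι → ℕ+) {I : Finset ι} (hI : I.Nonempty) (F : V) :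
    gen a b (block ν I * F) = block ν I * gen a b F +
      (a * (∑ i ∈ I, (ν i : ℕ)).descFactorial (#I - 1) / ∏ i ∈ I, ((ν i : ℕ)! : ℚ)) •
        gen (a - 1) (b + (∑ i ∈ I, (ν i : ℕ) + 1 - #I)) F := by
  have hcard := card_le_sum ν I
  have hpos := hI.card_pos
  obtain ⟨m, hm⟩ : ∃ m : ℕ+, (m : ℕ) = ∑ i ∈ I, (ν i : ℕ) + 1 - #I := ⟨⟨_, by omega⟩, rfl⟩
  have hfac := Nat.factorial_mul_descFactorial (show #I - 1 ≤ ∑ i ∈ I, (ν i : ℕ) by omega)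
  rw [show ∑ i ∈ I, (ν i : ℕ) - (#I - 1) = m by omega] at hfac
  rw [block, ← hm, x_coe, smul_mul_assoc, map_smul, gen_X_mul, smul_add, smul_smul,
    smul_mul_assoc, ← hfac]
  congr 2
  push_cast
  field_simp

variable [DecidableEq ι]

/-- The coefficient of the partition sums over `s \ A` in `gen a b (partitionSum ν c s)`, see
`gen_partitionSum`. -/
def genCoeff (ν : ι → ℕ+) (a b : ℕ) (A : Finset ι) : V :=
  (abelProd (fun i => (ν i : ℕ)) a A * (a + b + ∑ i ∈ A, (ν i : ℕ) - #A)! /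
    ∏ i ∈ A, ((ν i : ℕ)! : ℚ)) • x (a + b + ∑ i ∈ A, (ν i : ℕ) - #A - 1)

theorem genCoeff_empty (ν : ι → ℕ+) (a b : ℕ) :
    genCoeff ν a b ∅ = ((a + b)! : ℚ) • x (a + b - 1) := by
  simp [genCoeff, abelProd_empty]

theorem genCoeff_zero_of_nonempty (ν : ι → ℕ+) (b : ℕ) {A : Finset ι} (hA : A.Nonempty) :
    genCoeff ν 0 b A = 0 := by
  simp [genCoeff, abelProd, hA.ne_empty]

theorem smul_genCoeff_sdiff (ν : ι → ℕ+) (a b : ℕ) {i : ι} {B C : Finset ι} (hi : i ∉ C)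
    (hB : B ⊆ C) :
    ((a + 1 : ℕ) * (∑ j ∈ insert i (C \ B), (ν j : ℕ)).descFactorial (#(insert i (C \ B)) - 1) /
        ∏ j ∈ insert i (C \ B), ((ν j : ℕ)! : ℚ)) •
          genCoeff ν a (b + (∑ j ∈ insert i (C \ B), (ν j : ℕ) + 1 - #(insert i (C \ B)))) B =
      ((a + 1 : ℕ) * (a + b + (ν i + ∑ j ∈ C, (ν j : ℕ)) - #C)! /
          (∏ j ∈ insert i C, ((ν j : ℕ)! : ℚ)) * (abelProd (fun j => (ν j : ℕ)) a B *
            (ν i + ∑ j ∈ C \ B, (ν j : ℕ)).descFactorial #(C \ B) : ℕ)) •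
        x (a + b + (ν i + ∑ j ∈ C, (ν j : ℕ)) - #C - 1) := by
  have hi' : i ∉ C \ B := fun h => hi (sdiff_subset h)
  have hsum := sum_sdiff (f := fun j => (ν j : ℕ)) hB
  have hcard := card_sdiff_add_card_eq_card hB
  have hB' := card_le_sum ν B
  have hCB := card_le_sum ν (C \ B)
  have hindex : a + (b + (ν i + ∑ j ∈ C \ B, (ν j : ℕ) + 1 - (#(C \ B) + 1))) +
      ∑ j ∈ B, (ν j : ℕ) - #B = a + b + (ν i + ∑ j ∈ C, (ν j : ℕ)) - #C := by omega
  rw [genCoeff, smul_smul, sum_insert hi', card_insert_of_notMem hi', prod_insert hi',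
    prod_insert hi, ← prod_sdiff hB, hindex, Nat.add_sub_cancel]
  congr 1
  push_cast
  field_simp

theorem genCoeff_insert (ν : ι → ℕ+) (a b : ℕ) {i : ι} {C : Finset ι} (hi : i ∉ C) :
    genCoeff ν (a + 1) b (insert i C) = ∑ B ∈ C.powerset,
      ((a + 1 : ℕ) * (∑ j ∈ insert i (C \ B), (ν j : ℕ)).descFactorial (#(insert i (C \ B)) - 1) /
        ∏ j ∈ insert i (C \ B), ((ν j : ℕ)! : ℚ)) •
          genCoeff ν a (b + (∑ j ∈ insert i (C \ B), (ν j : ℕ) + 1 - #(insert i (C \ B)))) B := by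
  have hcard := card_le_sum ν C
  have hpos := (ν i).pos
  rw [sum_congr rfl fun B hB => smul_genCoeff_sdiff ν a b hi (mem_powerset.mp hB), ← sum_smul,
    ← mul_sum, ← Nat.cast_sum, sum_abelProd_mul_descFactorial (fun j => (ν j : ℕ)) a (ν i) C,
    genCoeff, abelProd_insert _ _ hi, sum_insert hi, card_insert_of_notMem hi,
    show a + 1 + b + (ν i + ∑ j ∈ C, (ν j : ℕ)) - (#C + 1) =
      a + b + (ν i + ∑ j ∈ C, (ν j : ℕ)) - #C by omega,
    show a + 1 + (ν i + ∑ j ∈ C, (ν j : ℕ)) - 1 = a + ν i + ∑ j ∈ C, (ν j : ℕ) by omega]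
  congr 1
  push_cast
  ring

theorem sum_block_mul_sum (ν : ι → ℕ+) (f : Finset ι → V) (c : ℤ) {i : ι} {s : Finset ι}
    (hi : i ∉ s) :
    ∑ A ∈ s.powerset, block ν (insert i A) * ∑ B ∈ (s \ A).powerset, f B *
        partitionSum ν (c - 1 - ν i - ∑ j ∈ A, (ν j : ℕ) - ∑ j ∈ B, (ν j : ℕ)) ((s \ A) \ B) =
      ∑ B ∈ s.powerset,
        f B * partitionSum ν (c - ∑ j ∈ B, (ν j : ℕ)) (insert i s \ B) := by
  simp only [mul_sum]
  rw [sum_powerset_powerset_comm s fun A B => block ν (insert i A) * (f B *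
    partitionSum ν (c - 1 - ν i - ∑ j ∈ A, (ν j : ℕ) - ∑ j ∈ B, (ν j : ℕ)) ((s \ A) \ B))]
  refine sum_congr rfl fun B hB => ?_
  rw [insert_sdiff_of_notMem _ fun h => hi (mem_powerset.mp hB h),
    partitionSum_insert ν _ fun h => hi (sdiff_subset h), mul_sum]
  refine sum_congr rfl fun A _ => ?_
  rw [mul_left_comm, sdiff_right_comm,
    show c - 1 - ν i - (∑ j ∈ A, (ν j : ℕ) : ℕ) - (∑ j ∈ B, (ν j : ℕ) : ℕ) =
      c - (∑ j ∈ B, (ν j : ℕ) : ℕ) - 1 - ν i - (∑ j ∈ A, (ν j : ℕ) : ℕ) by ring]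

theorem sum_smul_sum_genCoeff (ν : ι → ℕ+) (a b : ℕ) (c : ℤ) {i : ι} {s : Finset ι}
    (hi : i ∉ s) :
    ∑ A ∈ s.powerset, ((a + 1 : ℕ) *
          (∑ j ∈ insert i A, (ν j : ℕ)).descFactorial (#(insert i A) - 1) /
        ∏ j ∈ insert i A, ((ν j : ℕ)! : ℚ)) • ∑ B ∈ (s \ A).powerset,
          genCoeff ν a (b + (∑ j ∈ insert i A, (ν j : ℕ) + 1 - #(insert i A))) B *
            partitionSum ν (c - ∑ j ∈ A, (ν j : ℕ) - ∑ j ∈ B, (ν j : ℕ)) ((s \ A) \ B) =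
      ∑ C ∈ s.powerset, genCoeff ν (a + 1) b (insert i C) *
        partitionSum ν (c - ∑ j ∈ C, (ν j : ℕ)) (s \ C) := by
  simp only [smul_sum]
  rw [sum_powerset_powerset_sdiff s fun A B E => ((a + 1 : ℕ) *
      (∑ j ∈ insert i A, (ν j : ℕ)).descFactorial (#(insert i A) - 1) /
        ∏ j ∈ insert i A, ((ν j : ℕ)! : ℚ)) •
      (genCoeff ν a (b + (∑ j ∈ insert i A, (ν j : ℕ) + 1 - #(insert i A))) B *
        partitionSum ν (c - ∑ j ∈ A, (ν j : ℕ) - ∑ j ∈ B, (ν j : ℕ)) E)]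
  refine sum_congr rfl fun C hC => ?_
  rw [genCoeff_insert ν a b fun h => hi (mem_powerset.mp hC h), sum_mul]
  refine sum_congr rfl fun B hB => ?_
  rw [smul_mul_assoc, sub_sub, ← Nat.cast_add, sum_sdiff (mem_powerset.mp hB)]

theorem gen_partitionSum (a b : ℕ) (ν : ι → ℕ+) (c : ℤ) (s : Finset ι) :
    gen a b (partitionSum ν c s) = ∑ A ∈ s.powerset,
      genCoeff ν a b A * partitionSum ν (c - a - ∑ i ∈ A, (ν i : ℕ)) (s \ A) := by
  induction s using Finset.strongInduction generalizing a b c with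
  | H s ih =>
    obtain rfl | ⟨i, hi⟩ := s.eq_empty_or_nonempty
    · simp [partitionSum_empty, gen_divPow, genCoeff_empty]
    obtain ⟨t, hit, rfl⟩ : ∃ t, i ∉ t ∧ insert i t = s :=
      ⟨s.erase i, notMem_erase i s, insert_erase hi⟩
    cases a with
    | zero =>
      rw [gen_zero, sum_eq_single_of_mem ∅ (empty_mem_powerset _) fun A _ hA => by
        rw [genCoeff_zero_of_nonempty ν b (nonempty_iff_ne_empty.mpr hA), zero_mul]]
      simp [genCoeff_empty]
    | succ a =>
      have hsub (A : Finset ι) : t \ A ⊂ insert i t :=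
        sdiff_subset.trans_ssubset (ssubset_insert hit)
      simp only [partitionSum_insert ν c hit, map_sum, gen_block_mul _ _ ν (insert_nonempty i _),
        sum_add_distrib, ih _ (hsub _), Nat.add_sub_cancel]
      rw [sum_powerset_insert hit, ← sum_block_mul_sum ν _ _ hit]
      simp only [sub_right_comm _ _ (a : ℤ), sub_right_comm _ _ ((a + 1 : ℕ) : ℤ)]
      rw [sum_smul_sum_genCoeff ν a b _ hit]
      refine congrArg _ (sum_congr rfl fun C hC => ?_)
      have hiC : i ∉ C := fun h => hit (mem_powerset.mp hC h)
      rw [insert_sdiff_insert, sdiff_insert_of_notMem hit, sum_insert hiC]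
      congr 2
      push_cast
      ring

end PartitionSum

section PartitionSum

open Finset

variable {ι : Type*} [DecidableEq ι]

theorem abelProd_succ_mul_factorial (ν : ι → ℕ+) (n : ℕ) (A : Finset ι) :
    abelProd (fun i => (ν i : ℕ)) (n + 1) A * (n + 1 + ∑ i ∈ A, (ν i : ℕ) - #A)! =
      (n + 1) * (n + ∑ i ∈ A, (ν i : ℕ))! := by
  obtain rfl | hA := A.eq_empty_or_nonempty
  · simp [abelProd_empty, Nat.factorial_succ]
  have hcard := card_le_sum ν A
  have hpos := hA.card_pos
  rw [abelProd, if_neg hA.ne_empty, mul_assoc, mul_comm (Nat.descFactorial _ _),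
    ← Nat.factorial_mul_descFactorial (show #A - 1 ≤ n + ∑ i ∈ A, (ν i : ℕ) by omega)]
  congr 3 <;> omega

theorem smul_genCoeff_eq_block (ν : ι → ℕ+) {i : ι} {A : Finset ι} (hi : i ∉ A) :
    (1 / ((ν i + 1 : ℕ)! : ℚ)) • genCoeff ν (ν i + 1) 0 A = block ν (insert i A) := by
  have hfac := abelProd_succ_mul_factorial ν (ν i) A
  have hcard := card_le_sum ν A
  rw [genCoeff, block, sum_insert hi, card_insert_of_notMem hi, prod_insert hi, smul_smul,
    add_zero, ← Nat.cast_mul, hfac, Nat.factorial_succ,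
    show ν i + 1 + ∑ j ∈ A, (ν j : ℕ) - #A - 1 = ν i + ∑ j ∈ A, (ν j : ℕ) + 1 - (#A + 1) by omega]
  congr 1
  push_cast
  field_simp

theorem smul_gen_partitionSum (ν : ι → ℕ+) (c : ℤ) {i : ι} {s : Finset ι} (hi : i ∉ s) :
    (1 / ((ν i + 1 : ℕ)! : ℚ)) • gen (ν i + 1) 0 (partitionSum ν c s) =
      partitionSum ν c (insert i s) := by
  rw [gen_partitionSum, partitionSum_insert ν c hi, smul_sum]
  refine sum_congr rfl fun A hA => ?_
  rw [← smul_mul_assoc, smul_genCoeff_eq_block ν fun h => hi (mem_powerset.mp hA h)]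
  congr 2
  push_cast
  ring

theorem fourierSum_eq_partitionSum (g n : ℕ) {k : ℕ} (ν : Fin k → ℕ+) :
    fourierSum g n ν = partitionSum ν (g - n) univ := by
  refine sum_congr rfl fun P _ => ?_
  split_ifs with h
  · rw [show (g : ℤ) - n - #P.parts - (∑ i, (ν i : ℕ) : ℕ) =
      (g - n - #P.parts - ∑ i, (ν i : ℕ) : ℕ) by omega, divPow_natCast]
    rfl
  · rw [divPow_of_neg (by omega), zero_mul]

end PartitionSum

/-- The operator that corresponds to multiplication by `x_k` under the Fourier transform: it is `D`
for `k = 1` and `D_{k+1}` for `k ≥ 2`. -/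
def dual (g : ℕ) (k : ℕ+) : Module.End ℚ V :=
  (1 / ((k + 1 : ℕ)! : ℚ)) • hamOp g (k + 1) 0

theorem dual_one (g : ℕ) : dual g 1 = D g := by
  rw [D_eq_hamOp, dual]
  norm_num

theorem dual_eq_Dk (g : ℕ) {k : ℕ+} (hk : k ≠ 1) : dual g k = Dk (k + 1) := by
  have hk' : (k : ℕ) ≠ 1 := fun h => hk (PNat.eq h)
  have hpos := k.pos
  rw [dual, Dk_eq, hamOp_of_three_le g (by omega)]

theorem commute_dual (g : ℕ) (j k : ℕ+) : Commute (dual g j) (dual g k) := by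
  refine (Commute.smul_right (LinearMap.ext fun F => ?_) _).smul_left _
  have hj := j.pos
  have hk := k.pos
  simpa using hamOp_hamOp g (a := j + 1) (b := 0) (c := k + 1) (d := 0) (by omega) (by omega) F

theorem prod_dual_divPow (g : ℕ) {ι : Type*} [DecidableEq ι] (ν : ι → ℕ+) (hν : ∀ i, ν i ≠ 1)
    (c : ℤ) {l : List ι} (hl : l.Nodup) :
    (l.map fun i => dual g (ν i)).prod (divPow c) = partitionSum ν c l.toFinset := by
  induction l with
  | nil => simp [partitionSum_empty]
  | cons i l ih =>
    rw [List.nodup_cons] at hl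
    rw [List.map_cons, List.prod_cons, Module.End.mul_apply, ih hl.2, dual_eq_Dk g (hν i), Dk_eq,
      LinearMap.smul_apply, List.toFinset_cons, smul_gen_partitionSum ν c (by simpa using hl.1)]

theorem fourierSum_eq_prod_dual (g n : ℕ) (l : List ℕ+) (hl : ∀ i ∈ l, i ≠ 1) :
    fourierSum g n l.get = (l.map (dual g)).prod (divPow (g - n)) := by
  have hprod := prod_dual_divPow g l.get (fun i => hl _ (l.get_mem i)) (g - n)
    (List.nodup_finRange _)
  rw [List.toFinset_finRange] at hprod
  have hmap : l.map (dual g) = (List.finRange l.length).map fun i => dual g (l.get i) :=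
    (congrArg (List.map (dual g)) (List.map_get_finRange l)).symm.trans List.map_map
  rw [fourierSum_eq_partitionSum, ← hprod, hmap]

theorem fourier_monomial (g : ℕ) (m : ℕ+ →₀ ℕ) : fourier g (monomial m 1) =
    ((-1) ^ m 1 * (m 1)! : ℚ) • fourierSum g (m 1) (higherIndices m).get := by
  rw [fourier, show monomial m 1 = basisMonomials ℕ+ ℚ m by simp, Module.Basis.constr_basis]

theorem coe_higherIndices_append_replicate (m : ℕ+ →₀ ℕ) :
    ((higherIndices m ++ List.replicate (m 1) 1 : List ℕ+) : Multiset ℕ+) =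
      Finsupp.toMultiset m := by
  rw [← Multiset.coe_add, higherIndices, Multiset.sort_eq, Multiset.coe_replicate,
    ← Finsupp.count_toMultiset, ← Multiset.filter_eq']
  conv_rhs => rw [← Multiset.filter_add_not (1 < ·) (Finsupp.toMultiset m)]
  simp

theorem fourier_monomial_eq_prod_dual (g : ℕ) {m : ℕ+ →₀ ℕ} {l : List ℕ+}
    (hl : (l : Multiset ℕ+) = Finsupp.toMultiset m) :
    fourier g (monomial m 1) = (l.map (dual g)).prod (divPow g) := by
  have hperm : l.Perm (higherIndices m ++ List.replicate (m 1) 1) := by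
    rw [← Multiset.coe_eq_coe, coe_higherIndices_append_replicate, hl]
  have hcomm : (l.map (dual g)).Pairwise Commute :=
    List.pairwise_map.mpr (List.pairwise_of_forall fun j k => commute_dual g j k)
  have hhigher : ∀ i ∈ higherIndices m, i ≠ 1 := fun i hi =>
    (Multiset.mem_filter.mp ((Multiset.mem_sort _).mp hi)).2.ne'
  rw [(hperm.map (dual g)).prod_eq' hcomm, List.map_append, List.prod_append, List.map_replicate,
    List.prod_replicate, Module.End.mul_apply, dual_one, D_pow_divPow, map_smul, fourier_monomial,
    fourierSum_eq_prod_dual g _ _ hhigher]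

theorem fourier_one (g : ℕ) : fourier g 1 = divPow g := by
  simpa using fourier_monomial_eq_prod_dual g (m := 0) (l := []) (by simp)

theorem fourier_X_mul (g : ℕ) (k : ℕ+) (F : V) :
    fourier g (X k * F) = dual g k (fourier g F) := by
  induction F using MvPolynomial.induction_on' with
  | add F G hF hG => simp only [mul_add, map_add, hF, hG]
  | monomial m c =>
    have hl := Multiset.coe_toList (Finsupp.toMultiset m)
    have hcons : ((k :: (Finsupp.toMultiset m).toList : List ℕ+) : Multiset ℕ+) =
        Finsupp.toMultiset (Finsupp.single k 1 + m) := by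
      rw [← Multiset.cons_coe, hl]
      simp
    rw [← mul_one c, ← smul_eq_mul c 1, ← smul_monomial, mul_smul_comm, map_smul, map_smul,
      map_smul, X, monomial_mul, mul_one, fourier_monomial_eq_prod_dual g hcons,
      fourier_monomial_eq_prod_dual g hl, List.map_cons, List.prod_cons, Module.End.mul_apply]

theorem sum_get_higherIndices_add (m : ℕ+ →₀ ℕ) :
    ∑ i, deg ((higherIndices m).get i) + m 1 = Finsupp.weight deg m := by
  have hsum := congrArg (fun s => (s.map deg).sum) (coe_higherIndices_append_replicate m)
  simpa [show deg 1 = 1 from rfl, Finsupp.toMultiset_map, Finsupp.sum_toMultiset,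
    Finsupp.weight_apply, Finsupp.sum_mapDomain_index, add_mul, List.sum_ofFn] using hsum

theorem fourier_monomial_of_lt {g : ℕ} {m : ℕ+ →₀ ℕ} (hm : g < Finsupp.weight deg m) :
    fourier g (monomial m 1) = 0 := by
  have hsum : ∑ i, ((higherIndices m).get i : ℕ) + m 1 = Finsupp.weight deg m :=
    sum_get_higherIndices_add m
  rw [fourier_monomial, fourierSum, Finset.sum_eq_zero fun P _ => if_neg (by omega), smul_zero]

theorem fourier_divPow_self (g : ℕ) : fourier g (divPow g) = (-1 : ℚ) ^ g • 1 := by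
  have hpow : fourier g (X 1 ^ g) = ((-1) ^ g * g ! : ℚ) • 1 := by
    have hl : ((List.replicate g 1 : List ℕ+) : Multiset ℕ+) =
        Finsupp.toMultiset (Finsupp.single 1 g) := by
      rw [Multiset.coe_replicate, Finsupp.toMultiset_single, Multiset.nsmul_singleton]
    rw [X_pow_eq_monomial, fourier_monomial_eq_prod_dual g hl, List.map_replicate,
      List.prod_replicate, dual_one, D_pow_divPow]
    simp [divPow]
  rw [divPow_natCast, map_smul, hpow, smul_smul]
  congr 1
  field_simp

theorem isBihomogeneous_divPow (c : ℤ) : IsBihomogeneous (divPow c) c c := by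
  rw [divPow]
  split_ifs with hc
  · lift c to ℕ using hc
    rw [X_pow_eq_monomial]
    exact ((isBihomogeneous_monomial _ 1).smul _).congr (by simp [Finsupp.weight_single, deg])
      (by simp)
  · exact isWeightedHomogeneous_zero ℚ bideg _

theorem fourier_hamOp_zero (g : ℕ) {n : ℕ} (h : 2 ≤ n) (F : V) :
    fourier g (hamOp g 0 n F) = hamOp g n 0 (fourier g F) := by
  obtain ⟨k, rfl⟩ : ∃ k : ℕ+, n = k + 1 := ⟨⟨n - 1, by omega⟩, by simp; omega⟩
  rw [hamOp_zero_apply, map_smul, fourier_X_mul, dual, LinearMap.smul_apply, smul_smul,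
    mul_one_div_cancel (by positivity), one_smul]

theorem hamOp_smodEq {g a b : ℕ} (h : 2 ≤ a + b) {F G : V} (hFG : F ≡ G [SMOD relations g]) :
    hamOp g a b F ≡ hamOp g a b G [SMOD relations g] := by
  rw [SModEq.sub_mem, ← map_sub]
  exact hamOp_mem_relations h (SModEq.sub_mem.mp hFG)

theorem fourier_hamOp_one (g : ℕ) {a b : ℕ} (h : 2 ≤ a + 1 + b) :
    fourier g (hamOp g (a + 1) b 1) ≡
      (-1 : ℚ) ^ (a + 1) • hamOp g b (a + 1) (fourier g 1) [SMOD relations g] := by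
  rw [hamOp_succ_one, fourier_one, map_smul, fourier_one]
  have hbi := (isBihomogeneous_divPow g).hamOp g (show 2 ≤ b + (a + 1) by omega)
  split_ifs with hab
  · obtain ⟨rfl, rfl⟩ := hab
    rw [hamOp_one_one_apply g (isBihomogeneous_divPow g)]
    simp
  rw [zero_smul]
  refine (SModEq.zero.mpr (Submodule.smul_mem _ _ ?_)).symm
  obtain ha | ha := a.eq_zero_or_pos
  · rw [hamOp_of_three_le g (by omega)] at hbi ⊢
    exact mem_relations_of_mem_higher (hbi.congr (by omega) rfl).isWeightedHomogeneous_deg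
      (gen_mem_higher (by omega) _)
  · exact mem_relations_of_lt (show g < g + a by omega)
      (hbi.congr (by omega) rfl).isWeightedHomogeneous_deg

theorem fourier_hamOp_hamOp_zero {g a b n : ℕ} (h : 2 ≤ a + 1 + b) (hn : 2 ≤ n) {F : V}
    (hF : fourier g (hamOp g (a + 1) b F) ≡
      (-1 : ℚ) ^ (a + 1) • hamOp g b (a + 1) (fourier g F) [SMOD relations g])
    (hF' : fourier g (hamOp g a (b + n - 1) F) ≡
      (-1 : ℚ) ^ a • hamOp g (b + n - 1) a (fourier g F) [SMOD relations g]) :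
    fourier g (hamOp g (a + 1) b (hamOp g 0 n F)) ≡
      (-1 : ℚ) ^ (a + 1) • hamOp g b (a + 1) (fourier g (hamOp g 0 n F)) [SMOD relations g] := by
  rw [hamOp_hamOp g h (by omega), map_add, map_smul, fourier_hamOp_zero g hn,
    fourier_hamOp_zero g hn, hamOp_hamOp g (a := b) (by omega) (by omega)]
  simp only [add_zero, Nat.add_sub_cancel]
  convert (hamOp_smodEq (a := n) (b := 0) hn hF).add
    (hF'.smul ((a + 1 : ℕ) * n - b * (0 : ℕ) : ℚ)) using 1
  rw [map_smul, pow_succ]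
  push_cast
  module

theorem fourier_hamOp (g : ℕ) {a b : ℕ} (h : 2 ≤ a + b) (F : V) :
    fourier g (hamOp g a b F) ≡ (-1 : ℚ) ^ a • hamOp g b a (fourier g F) [SMOD relations g] := by
  induction a generalizing b F with
  | zero => rw [fourier_hamOp_zero g (by omega), pow_zero, one_smul]
  | succ a ih =>
    induction F using induction_X_mul with
    | one => exact fourier_hamOp_one g h
    | add F G hF hG => simpa only [map_add, smul_add] using hF.add hG
    | smul c F hF => simpa only [map_smul, smul_comm _ c] using hF.smul c
    | X_mul k F hF =>
      have hk := k.pos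
      have hX : X k * F = (1 / ((k + 1 : ℕ)! : ℚ)) • hamOp g 0 (k + 1) F := by
        rw [hamOp_zero_apply, smul_smul, one_div_mul_cancel (by positivity), one_smul]
      rw [hX, map_smul, map_smul, map_smul, map_smul, smul_comm]
      exact (fourier_hamOp_hamOp_zero h (by omega) hF (ih (by omega) F)).smul _

theorem fourier_dual (g : ℕ) (k : ℕ+) (F : V) :
    fourier g (dual g k F) ≡ (-1 : ℚ) ^ ((k : ℕ) + 1) • (X k * fourier g F)
      [SMOD relations g] := by
  have hk := k.pos
  convert (fourier_hamOp g (a := k + 1) (b := 0) (by omega) F).smul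
    (1 / ((k + 1 : ℕ)! : ℚ)) using 1
  · rw [← map_smul]
    rfl
  · rw [smul_comm, hamOp_zero_apply, smul_smul _ _ (X k * _), one_div_mul_cancel (by positivity),
      one_smul]

theorem fourier_mem_relations {g : ℕ} {F : V} (hF : F ∈ relations g) :
    fourier g F ∈ relations g := by
  rw [relations_eq_span] at hF
  induction hF using Submodule.span_induction with
  | zero => simp
  | add F G _ _ hF hG => simpa only [map_add] using add_mem hF hG
  | smul c F _ hF => simpa only [map_smul] using Submodule.smul_mem _ c hF
  | mem F hF =>
    obtain ⟨d, m, hm, rfl⟩ := hF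
    induction d with
    | zero => simp [fourier_monomial_of_lt hm]
    | succ d ih =>
      have hD := fourier_dual g 1 ((D g ^ d) (monomial m 1))
      rw [dual_one] at hD
      rw [pow_succ', Module.End.mul_apply, ← SModEq.zero]
      exact hD.trans (SModEq.zero.mpr (Submodule.smul_mem _ _ (mul_mem_relations _ ih)))

theorem dual_mem_relations {g : ℕ} (k : ℕ+) {F : V} (hF : F ∈ relations g) :
    dual g k F ∈ relations g :=
  Submodule.smul_mem _ _ (hamOp_mem_relations (by have := k.pos; omega) hF)

theorem fourier_fourier_X_mul (g : ℕ) (k : ℕ+) (F : V) :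
    fourier g (fourier g (X k * F)) ≡
      (-1 : ℚ) ^ ((k : ℕ) + 1) • (X k * fourier g (fourier g F)) [SMOD relations g] := by
  rw [fourier_X_mul]
  exact fourier_dual g k (fourier g F)

theorem fourier_smodEq {g : ℕ} {F G : V} (hFG : F ≡ G [SMOD relations g]) :
    fourier g F ≡ fourier g G [SMOD relations g] := by
  rw [SModEq.sub_mem, ← map_sub]
  exact fourier_mem_relations (SModEq.sub_mem.mp hFG)

theorem mul_smodEq {g : ℕ} (F : V) {G H : V} (h : G ≡ H [SMOD relations g]) :
    F * G ≡ F * H [SMOD relations g] := by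
  rw [SModEq.sub_mem, ← mul_sub]
  exact mul_mem_relations F (SModEq.sub_mem.mp h)

theorem fourier_pow_four_smodEq (g : ℕ) (F : V) :
    (fourier g ^ 4) F ≡ F [SMOD relations g] := by
  have hpow (G : V) : (fourier g ^ 4) G = fourier g (fourier g (fourier g (fourier g G))) := rfl
  induction F using induction_X_mul with
  | one =>
    have hsq : fourier g (fourier g 1) = (-1 : ℚ) ^ g • 1 := by
      rw [fourier_one, fourier_divPow_self]
    rw [hpow, hsq, map_smul, map_smul, hsq, smul_smul, ← mul_pow]
    simp
  | add F G hF hG => simpa only [map_add] using hF.add hG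
  | smul c F hF => simpa only [map_smul] using hF.smul c
  | X_mul k F hF =>
    rw [hpow] at hF ⊢
    set S := fourier g
    calc S (S (S (S (X k * F))))
      _ ≡ S (S ((-1 : ℚ) ^ ((k : ℕ) + 1) • (X k * S (S F)))) [SMOD relations g] :=
        fourier_smodEq (fourier_smodEq (fourier_fourier_X_mul g k F))
      _ = (-1 : ℚ) ^ ((k : ℕ) + 1) • S (S (X k * S (S F))) := by rw [map_smul, map_smul]
      _ ≡ (-1 : ℚ) ^ ((k : ℕ) + 1) • (-1 : ℚ) ^ ((k : ℕ) + 1) • (X k * S (S (S (S F))))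
          [SMOD relations g] := (fourier_fourier_X_mul g k (S (S F))).smul _
      _ = X k * S (S (S (S F))) := by rw [smul_smul, ← mul_pow]; simp
      _ ≡ X k * F [SMOD relations g] := mul_smodEq _ hF

/-- The operator induced on `V ⧸ J` by an operator on `V` that preserves the ideal `J`. -/
def descend {J : Ideal V} (A : Module.End ℚ V) (hA : ∀ F ∈ J, A F ∈ J) : Module.End ℚ (V ⧸ J) :=
  (J.restrictScalars ℚ).liftQ ((Ideal.Quotient.mkₐ ℚ J).toLinearMap ∘ₗ A)
      (fun F hF => Ideal.Quotient.eq_zero_iff_mem.mpr (hA F hF)) ∘ₗ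
    (Submodule.Quotient.restrictScalarsEquiv ℚ J).symm.toLinearMap

/-- The Fourier transform `S` on the ring `V ⧸ I_g`. -/
def fourierQuot (g : ℕ) : Module.End ℚ (V ⧸ relationsIdeal g) :=
  descend (fourier g) fun _ => fourier_mem_relations

/-- The operator `dual g k` on the ring `V ⧸ I_g`. -/
def dualQuot (g : ℕ) (k : ℕ+) : Module.End ℚ (V ⧸ relationsIdeal g) :=
  descend (dual g k) fun _ => dual_mem_relations k

theorem dualQuot_mk (g : ℕ) (k : ℕ+) (F : V) :
    dualQuot g k (Ideal.Quotient.mk _ F) = Ideal.Quotient.mk _ (dual g k F) := rfl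

theorem fourierQuot_pow_four (g : ℕ) : fourierQuot g ^ 4 = 1 := by
  refine LinearMap.ext fun u => ?_
  obtain ⟨F, rfl⟩ := Ideal.Quotient.mk_surjective u
  exact Ideal.Quotient.eq.mpr (SModEq.sub_mem.mp (fourier_pow_four_smodEq g F))

/-- The Fourier transform as an automorphism of the vector space `V ⧸ I_g`. -/
def fourierEquiv (g : ℕ) : (V ⧸ relationsIdeal g) ≃ₗ[ℚ] (V ⧸ relationsIdeal g) :=
  .ofLinearMap (fourierQuot g) (fourierQuot g ^ 3)
    ((pow_succ' _ 3).symm.trans (fourierQuot_pow_four g))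
    ((pow_succ _ 3).symm.trans (fourierQuot_pow_four g))

theorem fourierEquiv_mk (g : ℕ) (F : V) :
    fourierEquiv g (Ideal.Quotient.mk _ F) = Ideal.Quotient.mk _ (fourier g F) := rfl

theorem fourierEquiv_X_mul (g : ℕ) (k : ℕ+) (u : V ⧸ relationsIdeal g) :
    fourierEquiv g (Ideal.Quotient.mk _ (X k) * u) = dualQuot g k (fourierEquiv g u) := by
  obtain ⟨F, rfl⟩ := Ideal.Quotient.mk_surjective u
  rw [← map_mul, fourierEquiv_mk, fourierEquiv_mk, dualQuot_mk, fourier_X_mul]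

theorem fourierEquiv_X_mul_symm (g : ℕ) (k : ℕ+) (u : V ⧸ relationsIdeal g) :
    fourierEquiv g (Ideal.Quotient.mk _ (X k) * (fourierEquiv g).symm u) = dualQuot g k u := by
  rw [fourierEquiv_X_mul, LinearEquiv.apply_symm_apply]

theorem dual_toPNat' (g : ℕ) {k : ℕ} (hk : 3 ≤ k) : dual g (k - 1).toPNat' = Dk k := by
  have hcoe : ((k - 1).toPNat' : ℕ) = k - 1 := PNat.toPNat'_coe (by omega)
  have hne : (k - 1).toPNat' ≠ 1 := fun h => by
    rw [h, PNat.one_coe] at hcoe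
    omega
  rw [dual_eq_Dk g hne, hcoe, Nat.sub_add_cancel (by omega)]

theorem commute_Dk_D (g : ℕ) {k : ℕ} (hk : 3 ≤ k) : Commute (Dk k) (D g) := by
  rw [← dual_toPNat' g hk, ← dual_one]
  exact commute_dual g _ 1

end

end JacTaut

theorem theorem4 (g : ℕ) (hg : 2 ≤ g) :
    -- the operator `D` is `D₂ - g ∂₁`
    JacTaut.D g = JacTaut.Dk 2 - (g : ℚ) • JacTaut.partialOne ∧
    -- `[D_k, D] = 0` on `ℚ[x₁, x₂, …]` for `k ≥ 3`
    (∀ k : ℕ, 3 ≤ k → ⁅JacTaut.Dk k, JacTaut.D g⁆ = 0) ∧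
    -- `I_g` is an ideal `J`, so that `R = ℚ[x₁, x₂, …] / I_g` is a commutative ring
    ∃ J : Ideal JacTaut.V, J.restrictScalars ℚ = JacTaut.relations g ∧
      -- `S` and the `D_k` with `k ≥ 3` descend to `R`, and `S` becomes invertible there
      ∃ (S : (JacTaut.V ⧸ J) ≃ₗ[ℚ] (JacTaut.V ⧸ J)) (E : ℕ → Module.End ℚ (JacTaut.V ⧸ J)),
        (∀ F : JacTaut.V,
          S (Ideal.Quotient.mk J F) = Ideal.Quotient.mk J (JacTaut.fourier g F)) ∧
        (∀ k : ℕ, 3 ≤ k → ∀ F : JacTaut.V,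
          E k (Ideal.Quotient.mk J F) = Ideal.Quotient.mk J (JacTaut.Dk k F)) ∧
        -- `S(p_k · S⁻¹ F) = D_{k+1}(F)` on `R`, with `p_k` the class of `x_k`
        ∀ k : ℕ, 2 ≤ k → ∀ F : JacTaut.V ⧸ J,
          S (Ideal.Quotient.mk J (JacTaut.x k) * S.symm F) = E (k + 1) F := by
  refine ⟨JacTaut.D_eq g, fun k hk => (JacTaut.commute_Dk_D g hk).lie_eq, JacTaut.relationsIdeal g,
    rfl, JacTaut.fourierEquiv g, fun k => JacTaut.dualQuot g (k - 1).toPNat',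
    JacTaut.fourierEquiv_mk g, fun k hk F => ?_, fun k _ => ?_⟩
  · rw [JacTaut.dualQuot_mk, JacTaut.dual_toPNat' g hk]
  · exact JacTaut.fourierEquiv_X_mul_symm g k.toPNat'
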